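/- Lemma 3.1 (Duhamel's principle in ${}_\alpha H(0,T)$). Let $d\ge 1$, let $\Omega\subset\mathbb R^d$ be a bounded domain with smooth boundary, let $T>0$ and $0<\alpha<1$. All functions are real-valued. Let $$Av=-\sum_{i,j=1}^d\partial_j(a_{ij}\,\partial_i v)+\sum_{j=1}^d b_j\,\partial_j v+c\,v ,$$ where $a_{ij}=a_{ji}\in C^1(\overline\Omega)$, $b_j,c\in C(\overline\Omega)$, and for some $\kappa>0$ one has $\sum_{i,j}a_{ij}(x)\xi_i\xi_j\ge\kappa|\xi|^2$ for all $x\in\Omega$, $\xi\in\mathbb R^d$. For $\beta>0$ put $$(J_\beta v)(t)=\frac1{\Gamma(\beta)}\int_0^t(t-s)^{\beta-1}v(s)\,ds,\qquad 0<t<T .$$ For a Hilbert space $X$ let ${}_\alpha H(0,T;X)$ be the closure of $\{\varphi\in C^1([0,T];X):\varphi(0)=0\}$ in the Sobolev-Slobodecki space $H^\alpha(0,T;X)$, whose norm is $$\|v\|_{H^\alpha(0,T;X)}=\Big(\|v\|_{L^2(0,T;X)}^2+\int_0^T\!\!\int_0^T\frac{\|v(t)-v(s)\|_X^2}{|t-s|^{1+2\alpha}}\,dt\,ds\Big)^{1/2}.$$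 Let $\partial_t^\alpha=(J_\alpha)^{-1}$ on ${}_\alpha H(0,T;X)$, that is, $\partial_t^\alpha v=y$ in $L^2(0,T;X)$ means that $v\in{}_\alpha H(0,T;X)$, $y\in L^2(0,T;X)$ and $v=J_\alpha y$. Let $g\in L^2(0,T)$ and $f\in L^2(\Omega)$, and let $z$ satisfy $$\begin{cases}\partial_t^\alpha(z-f)+Az=0\quad\text{in }L^2(0,T;L^2(\Omega)),\\ z-f\in{}_\alpha H(0,T;L^2(\Omega)),\quad z\in L^2(0,T;H^2(\Omega)\cap H^1_0(\Omega)).\end{cases}$$ Then $$w(\cdot,t)=\int_0^t g(s)\,z(\cdot,t-s)\,ds,\qquad 0<t<T,$$ satisfies $$\begin{cases}(\partial_t^\alpha+A)w=(J_{1-\alpha}g)\,f\quad\text{in }L^2(0,T;L^2(\Omega)),\\ w\in{}_\alpha H(0,T;L^2(\Omega))\cap L^2(0,T;H^2(\Omega)\cap H^1_0(\Omega)).\end{cases}$$ -/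

import Mathlib

open MeasureTheory Set Filter
open scoped ContDiff ENNReal Topology

noncomputable section

namespace FracDuhamel

/-! ### Fractional calculus on a time interval, for functions with values in `X` -/

section Time

variable {X : Type*} [NormedAddCommGroup X] [NormedSpace ℝ X]

/-- Lebesgue measure on the time interval `(0,T)`. -/
abbrev timeMeasure (T : ℝ) : Measure ℝ := volume.restrict (Ioo 0 T)

/-- The forward Riemann-Liouville integral
`(J_β v)(t) = Γ(β)⁻¹ ∫₀ᵗ (t-s)^(β-1) v(s) ds`. -/
def rlIntegral (β : ℝ) (v : ℝ → X) (t : ℝ) : X :=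
  (Real.Gamma β)⁻¹ • ∫ s in (0 : ℝ)..t, (t - s) ^ (β - 1) • v s

/-- `₀C¹([0,T];X)`: continuously differentiable functions on `[0,T]` vanishing at `0`. -/
def zeroC1 (T : ℝ) : Set (ℝ → X) :=
  {φ | ContDiffOn ℝ 1 φ (Icc 0 T) ∧ φ 0 = 0}

/-- The Sobolev-Slobodecki norm of `H^α(0,T;X)`, with value `∞` allowed:
`(‖v‖²_{L²} + ∫₀ᵀ∫₀ᵀ ‖v(t)-v(s)‖² / |t-s|^(1+2α) dt ds)^(1/2)`. -/
def slobodeckiNorm (α T : ℝ) (v : ℝ → X) : ℝ≥0∞ :=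
  (eLpNorm v 2 (timeMeasure T) ^ 2 +
    ∫⁻ s in Ioo 0 T, ∫⁻ t in Ioo 0 T,
      ‖v t - v s‖ₑ ^ 2 / ENNReal.ofReal (|t - s| ^ (1 + 2 * α))) ^ (1 / 2 : ℝ)

/-- `H^α(0,T;X)`. -/
def fracSobolev (α T : ℝ) : Set (ℝ → X) :=
  {v | MemLp v 2 (timeMeasure T) ∧ slobodeckiNorm α T v < ⊤}

/-- `_αH(0,T;X)`: the closure of `₀C¹([0,T];X)` in `H^α(0,T;X)`. -/
def zeroFracSobolev (α T : ℝ) : Set (ℝ → X) :=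
  {v | v ∈ fracSobolev α T ∧
    ∀ ε : ℝ≥0∞, 0 < ε → ∃ φ ∈ zeroC1 T, slobodeckiNorm α T (fun t => v t - φ t) < ε}

/-- `∂_t^α v = y` in `L²(0,T;X)`, where `∂_t^α = (J_α)⁻¹` with domain `_αH(0,T;X)`:
`v` lies in `_αH(0,T;X)`, `y` lies in `L²(0,T;X)` and `J_α y = v`. -/
structure HasFracDeriv (α T : ℝ) (v y : ℝ → X) : Prop where
  mem_domain : v ∈ zeroFracSobolev α T
  memLp : MemLp y 2 (timeMeasure T)
  rlIntegral_eq : ∀ᵐ t ∂(timeMeasure T), rlIntegral α y t = v t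

end Time

/-! ### Sobolev spaces on a domain in `ℝ^d` -/

section Space

variable {d : ℕ}

/-- A bounded domain of `ℝ^d` with smooth boundary: near each of its boundary points it is
the region `φ < 0` of a smooth function `φ` with nonvanishing differential. -/
structure IsSmoothBoundedDomain (Ω : Set (EuclideanSpace ℝ (Fin d))) : Prop where
  isOpen : IsOpen Ω
  isConnected : IsConnected Ω
  isBounded : Bornology.IsBounded Ω
  smooth_boundary : ∀ x ∈ frontier Ω, ∃ U : Set (EuclideanSpace ℝ (Fin d)), IsOpen U ∧ x ∈ U ∧
    ∃ φ : EuclideanSpace ℝ (Fin d) → ℝ, ContDiffOn ℝ ∞ φ U ∧ fderiv ℝ φ x ≠ 0 ∧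
      ∀ y ∈ U, (y ∈ Ω ↔ φ y < 0)

/-- The real space `L²(Ω)`. -/
abbrev L2 (Ω : Set (EuclideanSpace ℝ (Fin d))) : Type := Lp ℝ 2 (volume.restrict Ω)

/-- The classical partial derivative `∂_i φ`. -/
def pderiv (i : Fin d) (φ : EuclideanSpace ℝ (Fin d) → ℝ) (x : EuclideanSpace ℝ (Fin d)) : ℝ :=
  fderiv ℝ φ x (EuclideanSpace.single i 1)

/-- `φ ∈ C_c^∞(Ω)`. -/
structure IsTest (Ω : Set (EuclideanSpace ℝ (Fin d))) (φ : EuclideanSpace ℝ (Fin d) → ℝ) :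
    Prop where
  smooth : ContDiff ℝ ∞ φ
  compact : HasCompactSupport φ
  support : tsupport φ ⊆ Ω

/-- `∂_i u = h` in `Ω` in the weak sense; used for `u` and `h` square integrable on `Ω`. -/
def HasWeakPartial (Ω : Set (EuclideanSpace ℝ (Fin d))) (i : Fin d)
    (u h : EuclideanSpace ℝ (Fin d) → ℝ) : Prop :=
  ∀ φ : EuclideanSpace ℝ (Fin d) → ℝ, IsTest Ω φ →
    ∫ x in Ω, u x * pderiv i φ x = -∫ x in Ω, h x * φ x

/-- First order jets with entries in `L²(Ω)`: `none` indexes a function and `some i` its `i`-th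
partial derivative. The norm is the `H¹(Ω)` norm. -/
abbrev Jet1 (Ω : Set (EuclideanSpace ℝ (Fin d))) : Type :=
  PiLp 2 (fun _ : Option (Fin d) => L2 Ω)

/-- Second order jets with entries in `L²(Ω)`: a first order jet, and for each `(i,j)` the
derivative `∂_j ∂_i`. The norm is the `H²(Ω)` norm. -/
abbrev Jet2 (Ω : Set (EuclideanSpace ℝ (Fin d))) : Type :=
  WithLp 2 (Jet1 Ω × PiLp 2 (fun _ : Fin d × Fin d => L2 Ω))

lemma IsTest.add {Ω : Set (EuclideanSpace ℝ (Fin d))} {φ ψ : EuclideanSpace ℝ (Fin d) → ℝ}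
    (hφ : IsTest Ω φ) (hψ : IsTest Ω ψ) : IsTest Ω (fun x => φ x + ψ x) where
  smooth := hφ.smooth.add hψ.smooth
  compact := hφ.compact.add hψ.compact
  support := (tsupport_add φ ψ).trans (union_subset hφ.support hψ.support)

lemma IsTest.const_mul {Ω : Set (EuclideanSpace ℝ (Fin d))} {φ : EuclideanSpace ℝ (Fin d) → ℝ}
    (c : ℝ) (hφ : IsTest Ω φ) : IsTest Ω (fun x => c * φ x) where
  smooth := contDiff_const.mul hφ.smooth
  compact := hφ.compact.mul_left
  support := (closure_mono (Function.support_mul_subset_right (fun _ => c) φ)).trans hφ.support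

lemma isTest_zero (Ω : Set (EuclideanSpace ℝ (Fin d))) : IsTest Ω (fun _ => 0) where
  smooth := contDiff_const
  compact := HasCompactSupport.zero
  support := by
    have h : tsupport (fun _ : EuclideanSpace ℝ (Fin d) => (0 : ℝ)) = ∅ := by
      rw [tsupport_eq_empty_iff]; rfl
    rw [h]; exact empty_subset _

lemma pderiv_add {Ω : Set (EuclideanSpace ℝ (Fin d))} {φ ψ : EuclideanSpace ℝ (Fin d) → ℝ}
    (hφ : IsTest Ω φ) (hψ : IsTest Ω ψ) (i : Fin d) (x : EuclideanSpace ℝ (Fin d)) :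
    pderiv i (fun x => φ x + ψ x) x = pderiv i φ x + pderiv i ψ x := by
  have h1 : DifferentiableAt ℝ φ x := hφ.smooth.differentiable (by simp) x
  have h2 : DifferentiableAt ℝ ψ x := hψ.smooth.differentiable (by simp) x
  simp only [pderiv]
  rw [fderiv_fun_add h1 h2]; rfl

lemma pderiv_const_mul {Ω : Set (EuclideanSpace ℝ (Fin d))} {φ : EuclideanSpace ℝ (Fin d) → ℝ}
    (hφ : IsTest Ω φ) (c : ℝ) (i : Fin d) (x : EuclideanSpace ℝ (Fin d)) :
    pderiv i (fun x => c * φ x) x = c * pderiv i φ x := by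
  have h1 : DifferentiableAt ℝ φ x := hφ.smooth.differentiable (by simp) x
  simp only [pderiv]
  rw [fderiv_const_mul h1]; rfl

lemma IsTest.continuous_pderiv {Ω : Set (EuclideanSpace ℝ (Fin d))}
    {φ : EuclideanSpace ℝ (Fin d) → ℝ} (hφ : IsTest Ω φ) (i : Fin d) :
    Continuous (pderiv i φ) := by
  have h : Continuous (fderiv ℝ φ) := hφ.smooth.continuous_fderiv (by simp)
  exact h.clm_apply continuous_const

lemma IsTest.hasCompactSupport_pderiv {Ω : Set (EuclideanSpace ℝ (Fin d))}
    {φ : EuclideanSpace ℝ (Fin d) → ℝ} (hφ : IsTest Ω φ) (i : Fin d) :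
    HasCompactSupport (pderiv i φ) :=
  hφ.compact.fderiv_apply ℝ (EuclideanSpace.single i 1)

lemma integrable_mul_of_compact {Ω : Set (EuclideanSpace ℝ (Fin d))} (u : L2 Ω)
    {φ : EuclideanSpace ℝ (Fin d) → ℝ} (hc : Continuous φ) (hs : HasCompactSupport φ) :
    Integrable (fun x => u x * φ x) (volume.restrict Ω) :=
  (Lp.memLp u).integrable_mul (q := 2) ((hc.memLp_of_hasCompactSupport hs).restrict Ω)

lemma HasWeakPartial.zero (Ω : Set (EuclideanSpace ℝ (Fin d))) (i : Fin d) :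
    HasWeakPartial Ω i ((0 : L2 Ω) : EuclideanSpace ℝ (Fin d) → ℝ) (0 : L2 Ω) := by
  intro φ _
  have h := Lp.coeFn_zero ℝ 2 (volume.restrict Ω)
  have key : ∀ ψ : EuclideanSpace ℝ (Fin d) → ℝ, ∫ x in Ω, (0 : L2 Ω) x * ψ x = 0 := fun ψ =>
    integral_eq_zero_of_ae (by
      filter_upwards [h] with x hx
      rw [hx, Pi.zero_apply, zero_mul])
  rw [key, key, neg_zero]

lemma HasWeakPartial.add {Ω : Set (EuclideanSpace ℝ (Fin d))} {i : Fin d} {u h u' h' : L2 Ω}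
    (H : HasWeakPartial Ω i u h) (H' : HasWeakPartial Ω i u' h') :
    HasWeakPartial Ω i (u + u' : L2 Ω) (h + h' : L2 Ω) := by
  intro φ hφ
  have e1 : ∫ x in Ω, (u + u' : L2 Ω) x * pderiv i φ x
      = ∫ x in Ω, (u x * pderiv i φ x + u' x * pderiv i φ x) :=
    integral_congr_ae (by
      filter_upwards [Lp.coeFn_add u u'] with x hx
      rw [hx, Pi.add_apply, add_mul])
  have e2 : ∫ x in Ω, (h + h' : L2 Ω) x * φ x = ∫ x in Ω, (h x * φ x + h' x * φ x) :=
    integral_congr_ae (by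
      filter_upwards [Lp.coeFn_add h h'] with x hx
      rw [hx, Pi.add_apply, add_mul])
  have c1 := hφ.continuous_pderiv i
  have c2 := hφ.hasCompactSupport_pderiv i
  rw [e1, e2, integral_add (integrable_mul_of_compact u c1 c2) (integrable_mul_of_compact u' c1 c2),
    integral_add (integrable_mul_of_compact h hφ.smooth.continuous hφ.compact)
      (integrable_mul_of_compact h' hφ.smooth.continuous hφ.compact), H φ hφ, H' φ hφ]
  ring

lemma HasWeakPartial.smul {Ω : Set (EuclideanSpace ℝ (Fin d))} {i : Fin d} {u h : L2 Ω} (c : ℝ)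
    (H : HasWeakPartial Ω i u h) : HasWeakPartial Ω i (c • u : L2 Ω) (c • h : L2 Ω) := by
  intro φ hφ
  have e1 : ∫ x in Ω, (c • u : L2 Ω) x * pderiv i φ x = ∫ x in Ω, c * (u x * pderiv i φ x) :=
    integral_congr_ae (by
      filter_upwards [Lp.coeFn_smul c u] with x hx
      rw [hx, Pi.smul_apply, smul_eq_mul, mul_assoc])
  have e2 : ∫ x in Ω, (c • h : L2 Ω) x * φ x = ∫ x in Ω, c * (h x * φ x) :=
    integral_congr_ae (by
      filter_upwards [Lp.coeFn_smul c h] with x hx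
      rw [hx, Pi.smul_apply, smul_eq_mul, mul_assoc])
  rw [e1, e2, integral_const_mul, integral_const_mul, H φ hφ]
  ring

/-- The jets of the functions in `C_c^∞(Ω)`. -/
def testJets (Ω : Set (EuclideanSpace ℝ (Fin d))) : Submodule ℝ (Jet1 Ω) where
  carrier := {U | ∃ φ : EuclideanSpace ℝ (Fin d) → ℝ, IsTest Ω φ ∧
    U none =ᵐ[volume.restrict Ω] φ ∧ ∀ i : Fin d, U (some i) =ᵐ[volume.restrict Ω] pderiv i φ}
  zero_mem' := by
    have h := Lp.coeFn_zero ℝ 2 (volume.restrict Ω)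
    refine ⟨fun _ => 0, isTest_zero Ω, ?_, fun i => ?_⟩
    · filter_upwards [h] with x hx
      exact hx
    · filter_upwards [h] with x hx
      have : pderiv i (fun _ : EuclideanSpace ℝ (Fin d) => (0 : ℝ)) x = 0 := by simp [pderiv]
      rw [this]; exact hx
  add_mem' := by
    rintro U V ⟨φ, hφ, h0, h1⟩ ⟨ψ, hψ, k0, k1⟩
    refine ⟨fun x => φ x + ψ x, hφ.add hψ, ?_, fun i => ?_⟩
    · filter_upwards [Lp.coeFn_add (U none) (V none), h0, k0] with x hx a b
      rw [PiLp.add_apply, hx, Pi.add_apply, a, b]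
    · filter_upwards [Lp.coeFn_add (U (some i)) (V (some i)), h1 i, k1 i] with x hx a b
      rw [PiLp.add_apply, hx, Pi.add_apply, a, b, pderiv_add hφ hψ]
  smul_mem' := by
    rintro c U ⟨φ, hφ, h0, h1⟩
    refine ⟨fun x => c * φ x, hφ.const_mul c, ?_, fun i => ?_⟩
    · filter_upwards [Lp.coeFn_smul c (U none), h0] with x hx a
      rw [PiLp.smul_apply, hx, Pi.smul_apply, a, smul_eq_mul]
    · filter_upwards [Lp.coeFn_smul c (U (some i)), h1 i] with x hx a
      rw [PiLp.smul_apply, hx, Pi.smul_apply, a, smul_eq_mul, pderiv_const_mul hφ]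

/-- `H¹₀(Ω)`, the closure of `C_c^∞(Ω)` in the `H¹(Ω)` norm; a function is represented by its
jet `(v, ∇v)`. -/
def H10 (Ω : Set (EuclideanSpace ℝ (Fin d))) : Submodule ℝ (Jet1 Ω) :=
  (testJets Ω).topologicalClosure

/-- The Sobolev space `H²(Ω)`, with its norm; a function in `L²(Ω)` which has all weak partial
derivatives up to order two in `L²(Ω)` is represented by the jet of these derivatives. -/
def H2 (Ω : Set (EuclideanSpace ℝ (Fin d))) : Submodule ℝ (Jet2 Ω) where
  carrier := {U | (∀ i : Fin d, HasWeakPartial Ω i (U.fst none) (U.fst (some i))) ∧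
    ∀ i j : Fin d, HasWeakPartial Ω j (U.fst (some i)) (U.snd (i, j))}
  zero_mem' := ⟨fun i => HasWeakPartial.zero Ω i, fun _ j => HasWeakPartial.zero Ω j⟩
  add_mem' := fun hU hV => ⟨fun i => (hU.1 i).add (hV.1 i), fun i j => (hU.2 i j).add (hV.2 i j)⟩
  smul_mem' := fun c _ hU => ⟨fun i => (hU.1 i).smul c, fun i j => (hU.2 i j).smul c⟩

/-- `H²(Ω) ∩ H¹₀(Ω)`, with the norm of `H²(Ω)`. -/
def H2H10 (Ω : Set (EuclideanSpace ℝ (Fin d))) : Submodule ℝ (Jet2 Ω) where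
  carrier := {U | U ∈ H2 Ω ∧ U.fst ∈ H10 Ω}
  zero_mem' := ⟨(H2 Ω).zero_mem, (H10 Ω).zero_mem⟩
  add_mem' := fun hU hV => ⟨(H2 Ω).add_mem hU.1 hV.1, (H10 Ω).add_mem hU.2 hV.2⟩
  smul_mem' := fun c _ hU => ⟨(H2 Ω).smul_mem c hU.1, (H10 Ω).smul_mem c hU.2⟩

/-- The embedding of `H²(Ω) ∩ H¹₀(Ω)` into `L²(Ω)`. -/
def H2H10.toL2 {Ω : Set (EuclideanSpace ℝ (Fin d))} (U : H2H10 Ω) : L2 Ω :=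
  (U : Jet2 Ω).fst none

/-- The `L²(Ω)`-valued function `z` belongs to `L²(0,T; H²(Ω) ∩ H¹₀(Ω))`. -/
def MemL2H2H10 (Ω : Set (EuclideanSpace ℝ (Fin d))) (T : ℝ) (z : ℝ → L2 Ω) : Prop :=
  ∃ Z : ℝ → H2H10 Ω, MemLp Z 2 (timeMeasure T) ∧ ∀ᵐ t ∂(timeMeasure T), z t = H2H10.toL2 (Z t)

/-! ### The elliptic operator -/

/-- `a ∈ C¹(Ω̄)`: `a` is continuous on `Ω̄` and differentiable in `Ω`, with a derivative that
extends continuously to `Ω̄`. -/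
def C1Closure (Ω : Set (EuclideanSpace ℝ (Fin d))) (a : EuclideanSpace ℝ (Fin d) → ℝ) : Prop :=
  ContinuousOn a (closure Ω) ∧
    ∃ D : EuclideanSpace ℝ (Fin d) → (EuclideanSpace ℝ (Fin d) →L[ℝ] ℝ),
      ContinuousOn D (closure Ω) ∧ ∀ x ∈ Ω, HasFDerivAt a (D x) x

/-- The coefficients of a uniformly elliptic operator
`A v = -∑_{i,j} ∂_j (a_ij ∂_i v) + ∑_j b_j ∂_j v + c v` on `Ω`. -/
structure EllipticOperator (Ω : Set (EuclideanSpace ℝ (Fin d))) where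
  a : Fin d → Fin d → EuclideanSpace ℝ (Fin d) → ℝ
  b : Fin d → EuclideanSpace ℝ (Fin d) → ℝ
  c : EuclideanSpace ℝ (Fin d) → ℝ
  a_symm : ∀ i j, ∀ x ∈ closure Ω, a i j x = a j i x
  a_C1 : ∀ i j, C1Closure Ω (a i j)
  b_cont : ∀ j, ContinuousOn (b j) (closure Ω)
  c_cont : ContinuousOn c (closure Ω)
  elliptic : ∃ κ : ℝ, 0 < κ ∧ ∀ x ∈ Ω, ∀ ξ : Fin d → ℝ,
    κ * ∑ j, ξ j ^ 2 ≤ ∑ i, ∑ j, a i j x * ξ i * ξ j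

/-- `A v = h` in `L²(Ω)`: the weak gradient `p` of `v`, and the weak derivatives
`q i j = ∂_j (a_ij ∂_i v)`, belong to `L²(Ω)`, and
`h = -∑_{i,j} ∂_j (a_ij ∂_i v) + ∑_j b_j ∂_j v + c v` almost everywhere in `Ω`. -/
def EllipticOperator.MapsTo {Ω : Set (EuclideanSpace ℝ (Fin d))} (A : EllipticOperator Ω)
    (v h : L2 Ω) : Prop :=
  ∃ (p : Fin d → L2 Ω) (q : Fin d → Fin d → L2 Ω),
    (∀ i, HasWeakPartial Ω i v (p i)) ∧
    (∀ i j, HasWeakPartial Ω j (fun x => A.a i j x * p i x) (q i j)) ∧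
    ∀ᵐ x ∂(volume.restrict Ω),
      h x = -(∑ i, ∑ j, q i j x) + ∑ j, A.b j x * p j x + A.c x * v x

/-- `∂_t^α v + A u = F` in `L²(0,T;L²(Ω))`, where both terms on the left-hand side belong to
`L²(0,T;L²(Ω))`. -/
def FracEquation {Ω : Set (EuclideanSpace ℝ (Fin d))} (A : EllipticOperator Ω) (α T : ℝ)
    (v u F : ℝ → L2 Ω) : Prop :=
  ∃ y h : ℝ → L2 Ω, HasFracDeriv α T v y ∧
    MemLp h 2 (timeMeasure T) ∧ (∀ᵐ t ∂(timeMeasure T), A.MapsTo (u t) (h t)) ∧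
    ∀ᵐ t ∂(timeMeasure T), y t + h t = F t

end Space

end FracDuhamel

end

open FracDuhamel

noncomputable section

namespace FracDuhamel

/-! ### Causal convolution -/

section CausalConv

open scoped Convolution

variable {X : Type*} [NormedAddCommGroup X] [NormedSpace ℝ X]

/-! Write `*` for causal convolution and `k_β(s) = s^(β-1)/Γ(β)`, so that `J_β v = k_β * v` and `w =
g * z`. With `v = z - f = k_α * y`, associativity and commutativity give `g * v = k_α * (g * y)`.
The Beta integral gives `k_α * k_{1-α} = 1`, so `g * f`, the primitive of `g` times `f`, equals `k_α
* ((J_{1-α} g) f)`. Hence `w = J_α ((J_{1-α} g) f + g * y)`, which is `rlIntegral_duhamel`. On `H² ∩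
H¹₀` the operator `A` is a bounded map `L` into `L²` (`EllipticOperator.exists_clm`), so it passes
under the Bochner integral; convolving `y + A z = 0` with `g` gives the equation for `w`.

The delicate point is that `w` lies in the closure `_αH` of the `C¹` functions vanishing at `0`. It
follows from boundedness of `u ↦ u * (v + f)` from `L²(0,T)` to `H^α`
(`slobodeckiNorm_causalConv_bound`). For `u * v`, extend `v` by zero to negative times: the
extension has finite energy because `v = J_α y` satisfies Hardy's inequality `t^(-α) v ∈ L²`
(`hardy_rlKernel`), and a superposition of translates obeys a Young-type bound
(`gagliardo_causalConv_le`). This fails for the constant `f` when `α ≥ 1/2`, since its extension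
jumps at `0`; but `u * f` is a primitive, with an `H¹`-type increment bound that suffices for `α <
1` (`gagliardo_primitive_le`). Finally `g` is an `L²` limit of `C¹` functions `G` vanishing for `s ≤
0`, and each `G * z` is `C¹` and zero at `0`. -/

/-- The causal convolution `∫₀ᵗ a(s) u(t-s) ds`. -/
def causalConv (a : ℝ → ℝ) (u : ℝ → X) (t : ℝ) : X := ∫ s in (0 : ℝ)..t, a s • u (t - s)

lemma causalConv_eq_setIntegral (a : ℝ → ℝ) (u : ℝ → X) {t : ℝ} (ht : 0 ≤ t) :
    causalConv a u t = ∫ s in Ioo 0 t, a s • u (t - s) := by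
  rw [causalConv, intervalIntegral.integral_of_le ht, integral_Ioc_eq_integral_Ioo]

lemma indicator_mul_eq_indicator {T t : ℝ} (ht : t ∈ Ioo 0 T) (a : ℝ → ℝ) (u : ℝ → X) (s : ℝ) :
    (Ioo 0 T).indicator a s • (Ioo 0 T).indicator u (t - s)
      = (Ioo 0 t).indicator (fun s => a s • u (t - s)) s := by
  by_cases h : s ∈ Ioo 0 t
  · rw [indicator_of_mem h, indicator_of_mem (show s ∈ Ioo 0 T from ⟨h.1, h.2.trans ht.2⟩),
      indicator_of_mem (show t - s ∈ Ioo 0 T from ⟨sub_pos.2 h.2, by linarith [h.1, ht.2]⟩)]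
  · rw [indicator_of_notMem h]
    by_cases h0 : 0 < s
    · have : t - s ∉ Ioo 0 T := fun h' => h ⟨h0, sub_pos.1 h'.1⟩
      rw [indicator_of_notMem this, smul_zero]
    · rw [indicator_of_notMem (fun h' => h0 h'.1), zero_smul]

/-- For `t < T` the cut-offs at `T` are invisible, since `s` and `t - s` both positive already
forces both below `T`. This reduces existence, measurability and norm bounds to convolution on the
whole line. -/
lemma causalConv_eq_convolution {T t : ℝ} (ht : t ∈ Ioo 0 T) (a : ℝ → ℝ) (u : ℝ → X) :
    causalConv a u t = ((Ioo 0 T).indicator a ⋆ (Ioo 0 T).indicator u) t := by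
  rw [causalConv_eq_setIntegral a u ht.1.le, convolution_lsmul,
    ← integral_indicator measurableSet_Ioo]
  exact integral_congr_ae (Eventually.of_forall fun s => (indicator_mul_eq_indicator ht a u s).symm)

lemma indicator_ae_eq_of_ae_eq {Y : Type*} [Zero Y] {T : ℝ} {u u' : ℝ → Y}
    (h : u =ᵐ[timeMeasure T] u') : (Ioo 0 T).indicator u =ᵐ[volume] (Ioo 0 T).indicator u' := by
  filter_upwards [(ae_restrict_iff' measurableSet_Ioo).1 h] with t ht
  by_cases h' : t ∈ Ioo 0 T
  · rw [indicator_of_mem h', indicator_of_mem h', ht h']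
  · rw [indicator_of_notMem h', indicator_of_notMem h']

lemma causalConv_congr {T t : ℝ} (ht : t ∈ Ioo 0 T) {a a' : ℝ → ℝ} {u u' : ℝ → X}
    (ha : a =ᵐ[timeMeasure T] a') (hu : u =ᵐ[timeMeasure T] u') :
    causalConv a u t = causalConv a' u' t := by
  rw [causalConv_eq_convolution ht, causalConv_eq_convolution ht,
    convolution_congr _ (indicator_ae_eq_of_ae_eq ha) (indicator_ae_eq_of_ae_eq hu)]

lemma causalConv_comm (a b : ℝ → ℝ) (t : ℝ) : causalConv a b t = causalConv b a t := by
  have := intervalIntegral.integral_comp_sub_left (fun s => b s • a (t - s)) t (a := 0) (b := t)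
  simp only [sub_sub_cancel, sub_self, sub_zero] at this
  rw [causalConv, causalConv, ← this]
  simp [mul_comm]

lemma causalConv_smul_const [CompleteSpace X] (a b : ℝ → ℝ) (f : X) (t : ℝ) :
    causalConv a (fun s => b s • f) t = causalConv a b t • f := by
  simp only [causalConv, smul_eq_mul, ← mul_smul]
  rw [intervalIntegral.integral_smul_const]

/-- The integrand of `causalConv a u t` is integrable. -/
def CausalConvExists (a : ℝ → ℝ) (u : ℝ → X) (t : ℝ) : Prop :=
  IntegrableOn (fun s => a s • u (t - s)) (Ioo 0 t)

lemma causalConvExists_iff {T t : ℝ} (ht : t ∈ Ioo 0 T) (a : ℝ → ℝ) (u : ℝ → X) :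
    CausalConvExists a u t ↔ ConvolutionExistsAt ((Ioo 0 T).indicator a) ((Ioo 0 T).indicator u) t
      (ContinuousLinearMap.lsmul ℝ ℝ) volume := by
  rw [CausalConvExists, ← integrable_indicator_iff measurableSet_Ioo, ConvolutionExistsAt]
  exact integrable_congr
    (Eventually.of_forall fun s => (indicator_mul_eq_indicator ht a u s).symm)

lemma CausalConvExists.add_right {a : ℝ → ℝ} {u v : ℝ → X} {t : ℝ} (ht : 0 ≤ t)
    (hu : CausalConvExists a u t) (hv : CausalConvExists a v t) :
    causalConv a (fun s => u s + v s) t = causalConv a u t + causalConv a v t := by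
  simp only [causalConv_eq_setIntegral _ _ ht, smul_add]
  exact integral_add hu hv

lemma CausalConvExists.sub_left {a b : ℝ → ℝ} {u : ℝ → X} {t : ℝ} (ht : 0 ≤ t)
    (ha : CausalConvExists a u t) (hb : CausalConvExists b u t) :
    causalConv (fun s => a s - b s) u t = causalConv a u t - causalConv b u t := by
  simp only [causalConv_eq_setIntegral _ _ ht, sub_smul]
  exact integral_sub ha hb

lemma clm_causalConv {Y : Type*} [NormedAddCommGroup Y] [NormedSpace ℝ Y] [CompleteSpace X]
    [CompleteSpace Y] (L : X →L[ℝ] Y) {a : ℝ → ℝ} {u : ℝ → X} {t : ℝ} (ht : 0 ≤ t)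
    (h : CausalConvExists a u t) :
    L (causalConv a u t) = causalConv a (fun s => L (u s)) t := by
  simp only [causalConv_eq_setIntegral _ _ ht, ← map_smul]
  exact (L.integral_comp_comm h).symm

lemma ae_causalConvExists {T : ℝ} {a : ℝ → ℝ} {u : ℝ → X} (ha : Integrable a (timeMeasure T))
    (hu : Integrable u (timeMeasure T)) :
    ∀ᵐ t ∂(timeMeasure T), CausalConvExists a u t := by
  have ha' := (integrable_indicator_iff measurableSet_Ioo).2 ha
  have hu' := (integrable_indicator_iff measurableSet_Ioo).2 hu
  have h := ha'.ae_convolution_exists (ContinuousLinearMap.lsmul ℝ ℝ) hu'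
  filter_upwards [ae_restrict_of_ae h, ae_restrict_mem measurableSet_Ioo] with t h1 h2
  exact (causalConvExists_iff h2 a u).2 h1

lemma integrable_causalConv {T : ℝ} {a : ℝ → ℝ} {u : ℝ → X} (ha : Integrable a (timeMeasure T))
    (hu : Integrable u (timeMeasure T)) : Integrable (causalConv a u) (timeMeasure T) := by
  have ha' := (integrable_indicator_iff measurableSet_Ioo).2 ha
  have hu' := (integrable_indicator_iff measurableSet_Ioo).2 hu
  have h := (ha'.integrable_convolution (ContinuousLinearMap.lsmul ℝ ℝ) hu').restrict
    (s := Ioo 0 T)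
  refine h.congr ?_
  filter_upwards [ae_restrict_mem measurableSet_Ioo] with t ht
  exact (causalConv_eq_convolution ht a u).symm

/-- Nothing is asked of `A` and `U` beyond `T`: vanishing on the negative axis confines the
integrand to `(0,t)`. Thus a convolution of two cut-off functions, which need not vanish after `T`,
can itself serve as a factor. -/
lemma causalConv_eq_convolution_of_eqOn {T t : ℝ} (ht : t ∈ Ioo 0 T) {a A : ℝ → ℝ} {u U : ℝ → X}
    (hA : EqOn A a (Ioo 0 T)) (hA0 : ∀ s ≤ 0, A s = 0)
    (hU : EqOn U u (Ioo 0 T)) (hU0 : ∀ s ≤ 0, U s = 0) :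
    causalConv a u t = (A ⋆ U) t := by
  rw [causalConv_eq_setIntegral a u ht.1.le, convolution_lsmul,
    ← integral_indicator measurableSet_Ioo]
  refine integral_congr_ae (Eventually.of_forall fun s => ?_)
  by_cases h : s ∈ Ioo 0 t
  · simp only [indicator_of_mem h]
    rw [hA ⟨h.1, h.2.trans ht.2⟩, hU ⟨sub_pos.2 h.2, by linarith [h.1, ht.2]⟩]
  · simp only [indicator_of_notMem h]
    by_cases h0 : 0 < s
    · rw [hU0 _ (by by_contra h'; exact h ⟨h0, by linarith⟩), smul_zero]
    · rw [hA0 _ (not_lt.1 h0), zero_smul]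

lemma convolution_indicator_nonpos {T s : ℝ} (hs : s ≤ 0) (a : ℝ → ℝ) (u : ℝ → X) :
    ((Ioo 0 T).indicator a ⋆ (Ioo 0 T).indicator u) s = 0 := by
  rw [convolution_lsmul]
  refine integral_eq_zero_of_ae (Eventually.of_forall fun r => ?_)
  by_cases h0 : 0 < r
  · have : s - r ∉ Ioo 0 T := fun h' => by linarith [h'.1]
    simp [indicator_of_notMem this]
  · have : r ∉ Ioo 0 T := fun h' => h0 h'.1
    simp [indicator_of_notMem this]

/-- Fubini for the triple integral requires `|a| * (|b| * |u|)` to exist at `t`; for integrable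
factors this holds at almost every `t`, whence the a.e. conclusion. -/
lemma causalConv_assoc [CompleteSpace X] {T : ℝ} {a b : ℝ → ℝ} {u : ℝ → X}
    (ha : Integrable a (timeMeasure T)) (hb : Integrable b (timeMeasure T))
    (hu : Integrable u (timeMeasure T)) :
    ∀ᵐ t ∂(timeMeasure T),
      causalConv (causalConv a b) u t = causalConv a (causalConv b u) t := by
  have ha' := (integrable_indicator_iff measurableSet_Ioo).2 ha
  have hb' := (integrable_indicator_iff measurableSet_Ioo).2 hb
  have hu' := (integrable_indicator_iff measurableSet_Ioo).2 hu
  have hi := (hb'.norm.integrable_convolution (ContinuousLinearMap.mul ℝ ℝ) hu'.norm)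
  have h := ha'.norm.ae_convolution_exists (ContinuousLinearMap.mul ℝ ℝ) hi
  filter_upwards [ae_restrict_of_ae h, ae_restrict_mem measurableSet_Ioo] with t h1 ht
  rw [causalConv_eq_convolution_of_eqOn (A := (Ioo 0 T).indicator a ⋆ (Ioo 0 T).indicator b)
      (U := (Ioo 0 T).indicator u) ht
      (fun s hs => (causalConv_eq_convolution hs a b).symm)
      (fun s hs => convolution_indicator_nonpos hs a b)
      (fun s hs => indicator_of_mem hs u)
      (fun s hs => indicator_of_notMem (fun h' => absurd h'.1 (not_lt.2 hs)) u),
    causalConv_eq_convolution_of_eqOn (A := (Ioo 0 T).indicator a)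
      (U := (Ioo 0 T).indicator b ⋆ (Ioo 0 T).indicator u) ht
      (fun s hs => indicator_of_mem hs a)
      (fun s hs => indicator_of_notMem (fun h' => absurd h'.1 (not_lt.2 hs)) a)
      (fun s hs => (causalConv_eq_convolution hs b u).symm)
      (fun s hs => convolution_indicator_nonpos hs b u)]
  exact convolution_assoc _ _ _ _ (fun x y z => mul_smul x y z)
    ha'.aestronglyMeasurable hb'.aestronglyMeasurable hu'.aestronglyMeasurable
    (ha'.ae_convolution_exists _ hb') (hb'.norm.ae_convolution_exists _ hu'.norm) h1

/-- Cauchy–Schwarz gives existence at every `t`, whereas merely integrable factors give it only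
almost everywhere. -/
lemma causalConvExists_of_memLp_two {T t : ℝ} (ht : t ∈ Ioo 0 T) {a : ℝ → ℝ} {u : ℝ → X}
    (ha : MemLp a 2 (timeMeasure T)) (hu : MemLp u 2 (timeMeasure T)) :
    CausalConvExists a u t := by
  rw [causalConvExists_iff ht]
  have ha' := (memLp_indicator_iff_restrict measurableSet_Ioo).2 ha
  have hu' := (memLp_indicator_iff_restrict measurableSet_Ioo).2 hu
  have hu'' : MemLp (fun s => (Ioo 0 T).indicator u (t - s)) 2 volume :=
    hu'.comp_measurePreserving (Measure.measurePreserving_sub_left volume t)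
  exact memLp_one_iff_integrable.1 (hu''.smul ha')

lemma enorm_causalConv_le {T t : ℝ} (ht : t ∈ Ioo 0 T) {a : ℝ → ℝ} {u : ℝ → X}
    (ha : MemLp a 2 (timeMeasure T)) (hu : MemLp u 2 (timeMeasure T)) :
    ‖causalConv a u t‖ₑ ≤ eLpNorm a 2 (timeMeasure T) * eLpNorm u 2 (timeMeasure T) := by
  have ha' := (memLp_indicator_iff_restrict measurableSet_Ioo).2 ha
  have hu' := (memLp_indicator_iff_restrict measurableSet_Ioo).2 hu
  have hmp := Measure.measurePreserving_sub_left (volume : Measure ℝ) t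
  have hu'' : MemLp (fun s => (Ioo 0 T).indicator u (t - s)) 2 volume :=
    hu'.comp_measurePreserving hmp
  have h := eLpNorm_smul_le_mul_eLpNorm (p := 2) (q := 2) (r := 1) hu''.1 ha'.1
  rw [causalConv_eq_convolution ht, convolution_lsmul]
  refine (enorm_integral_le_lintegral_enorm _).trans ?_
  rw [eLpNorm_one_eq_lintegral_enorm] at h
  refine h.trans (le_of_eq ?_)
  have e := eLpNorm_comp_measurePreserving (p := 2) hu'.1 hmp
  rw [← eLpNorm_indicator_eq_eLpNorm_restrict measurableSet_Ioo,
    ← eLpNorm_indicator_eq_eLpNorm_restrict measurableSet_Ioo, ← e]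
  rfl

lemma integrable_of_memLp_two {E : Type*} [NormedAddCommGroup E] {T : ℝ} {u : ℝ → E} (hu : MemLp u 2 (timeMeasure T)) :
    Integrable u (timeMeasure T) :=
  hu.integrable (by norm_num)

lemma memLp_causalConv_of_memLp_two {T : ℝ} {a : ℝ → ℝ} {u : ℝ → X}
    (ha : MemLp a 2 (timeMeasure T)) (hu : MemLp u 2 (timeMeasure T)) :
    MemLp (causalConv a u) 2 (timeMeasure T) := by
  have hm := (integrable_causalConv (integrable_of_memLp_two ha)
    (integrable_of_memLp_two hu)).aestronglyMeasurable
  refine MemLp.of_bound hm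
    (eLpNorm a 2 (timeMeasure T) * eLpNorm u 2 (timeMeasure T)).toReal ?_
  filter_upwards [ae_restrict_mem measurableSet_Ioo] with t ht
  rw [← toReal_enorm]
  exact ENNReal.toReal_mono (ENNReal.mul_ne_top ha.2.ne hu.2.ne) (enorm_causalConv_le ht ha hu)

/-- Cauchy–Schwarz with respect to the weighted measure `k dμ`, from the splitting `k F = k^(1/2) ·
(k^(1/2) F)`. -/
lemma sq_lintegral_mul_le {Y : Type*} [MeasurableSpace Y] {μ : Measure Y} {k F : Y → ℝ≥0∞}
    (hk : AEMeasurable k μ) (hF : AEMeasurable F μ) :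
    (∫⁻ y, k y * F y ∂μ) ^ 2 ≤ (∫⁻ y, k y ∂μ) * ∫⁻ y, k y * F y ^ 2 ∂μ := by
  have h := ENNReal.lintegral_mul_le_Lp_mul_Lq μ (p := 2) (q := 2)
    (Real.HolderConjugate.two_two) (f := fun y => k y ^ (1 / 2 : ℝ))
    (g := fun y => k y ^ (1 / 2 : ℝ) * F y) (hk.pow_const _) ((hk.pow_const _).mul hF)
  have e0 : ∀ x : ℝ≥0∞, x ^ (1 / 2 : ℝ) * x ^ (1 / 2 : ℝ) = x := fun x => by
    rw [← ENNReal.rpow_add_of_nonneg _ _ (by norm_num) (by norm_num)]; norm_num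
  have e1 : ∀ x : ℝ≥0∞, (x ^ (1 / 2 : ℝ)) ^ (2 : ℝ) = x := fun x => by
    rw [← ENNReal.rpow_mul]; norm_num
  have e2 : ∀ x : ℝ≥0∞, (x ^ (1 / 2 : ℝ)) ^ 2 = x := fun x => by rw [sq, e0]
  simp only [Pi.mul_apply, ← mul_assoc, e0, e1,
    ENNReal.mul_rpow_of_nonneg _ _ (zero_le_two : (0 : ℝ) ≤ 2)] at h
  calc _ ≤ _ := pow_le_pow_left₀ (zero_le) h 2
    _ = _ := by rw [mul_pow, e2, e2]; simp

lemma eLpNorm_two_sq {Y E : Type*} [MeasurableSpace Y] [NormedAddCommGroup E] (μ : Measure Y)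
    (u : Y → E) : eLpNorm u 2 μ ^ 2 = ∫⁻ y, ‖u y‖ₑ ^ 2 ∂μ := by
  simpa using eLpNorm_nnreal_pow_eq_lintegral (p := 2) (f := u) (μ := μ) (by norm_num)

/-- Young's inequality: causal convolution with an integrable kernel preserves `L²`. -/
lemma memLp_causalConv_of_integrable {T : ℝ} {a : ℝ → ℝ} {u : ℝ → X}
    (ha : Integrable a (timeMeasure T)) (hu : MemLp u 2 (timeMeasure T)) :
    MemLp (causalConv a u) 2 (timeMeasure T) := by
  have hm := (integrable_causalConv ha (integrable_of_memLp_two hu)).aestronglyMeasurable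
  refine ⟨hm, ?_⟩
  set A := (Ioo 0 T).indicator a
  set U := (Ioo 0 T).indicator u
  have ha' : Integrable A := (integrable_indicator_iff measurableSet_Ioo).2 ha
  have hu' : MemLp U 2 volume := (memLp_indicator_iff_restrict measurableSet_Ioo).2 hu
  -- Cauchy–Schwarz with weight `|A|`, then Tonelli and translation invariance, bound the square by
  -- `‖A‖₁² ‖U‖₂²`.
  have key : eLpNorm (causalConv a u) 2 (timeMeasure T) ^ 2
      ≤ (∫⁻ s, ‖A s‖ₑ) * ((∫⁻ s, ‖A s‖ₑ) * ∫⁻ t, ‖U t‖ₑ ^ 2) := by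
    rw [eLpNorm_two_sq]
    have hmeas : AEMeasurable (fun p : ℝ × ℝ => ‖A p.2‖ₑ * ‖U (p.1 - p.2)‖ₑ ^ 2)
        (volume.prod volume) := by
      refine AEMeasurable.mul ha'.1.comp_snd.enorm (AEMeasurable.pow_const ?_ 2)
      exact (hu'.1.comp_quasiMeasurePreserving
        (quasiMeasurePreserving_sub_of_right_invariant volume volume)).enorm
    calc ∫⁻ t in Ioo 0 T, ‖causalConv a u t‖ₑ ^ 2
        ≤ ∫⁻ t in Ioo 0 T, (∫⁻ s, ‖A s‖ₑ) * ∫⁻ s, ‖A s‖ₑ * ‖U (t - s)‖ₑ ^ 2 := by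
          refine setLIntegral_mono' measurableSet_Ioo fun t ht => ?_
          have hU : AEStronglyMeasurable (fun s => U (t - s)) volume :=
            hu'.1.comp_measurePreserving (Measure.measurePreserving_sub_left volume t)
          refine le_trans (pow_le_pow_left₀ (zero_le) ?_ 2)
            (sq_lintegral_mul_le ha'.1.enorm hU.enorm)
          rw [causalConv_eq_convolution ht, convolution_lsmul]
          refine (enorm_integral_le_lintegral_enorm _).trans (le_of_eq ?_)
          simp only [enorm_smul]; rfl
      _ ≤ ∫⁻ t, (∫⁻ s, ‖A s‖ₑ) * ∫⁻ s, ‖A s‖ₑ * ‖U (t - s)‖ₑ ^ 2 := setLIntegral_le_lintegral _ _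
      _ = (∫⁻ s, ‖A s‖ₑ) * ∫⁻ t, ∫⁻ s, ‖A s‖ₑ * ‖U (t - s)‖ₑ ^ 2 :=
          lintegral_const_mul' _ _ ha'.2.ne
      _ = (∫⁻ s, ‖A s‖ₑ) * ∫⁻ s, ∫⁻ t, ‖A s‖ₑ * ‖U (t - s)‖ₑ ^ 2 := by
          rw [lintegral_lintegral_swap hmeas]
      _ = (∫⁻ s, ‖A s‖ₑ) * ∫⁻ s, ‖A s‖ₑ * ∫⁻ t, ‖U t‖ₑ ^ 2 := by
          congr 1
          refine lintegral_congr fun s => ?_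
          rw [lintegral_const_mul' _ _ enorm_ne_top,
            lintegral_sub_right_eq_self (fun t => ‖U t‖ₑ ^ 2) s]
      _ = _ := by
          rw [lintegral_mul_const'' _ ha'.1.enorm]
  have hfin : eLpNorm (causalConv a u) 2 (timeMeasure T) ^ 2 < ⊤ := by
    refine key.trans_lt (ENNReal.mul_lt_top ha'.2 (ENNReal.mul_lt_top ha'.2 ?_))
    rw [← eLpNorm_two_sq]
    exact ENNReal.pow_lt_top hu'.2
  by_contra h
  rw [not_lt, top_le_iff] at h
  simp [h] at hfin

end CausalConv

/-! ### The Riemann-Liouville kernel -/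

section Kernel

variable {X : Type*} [NormedAddCommGroup X] [NormedSpace ℝ X]

/-- The Riemann-Liouville kernel `s^(β-1) / Γ(β)`. -/
def rlKernel (β s : ℝ) : ℝ := (Real.Gamma β)⁻¹ * s ^ (β - 1)

lemma rlIntegral_eq_causalConv (β : ℝ) (v : ℝ → X) (t : ℝ) :
    rlIntegral β v t = causalConv (rlKernel β) v t := by
  have := intervalIntegral.integral_comp_sub_left
    (fun s => rlKernel β s • v (t - s)) t (a := 0) (b := t)
  simp only [sub_sub_cancel, sub_self, sub_zero] at this
  rw [causalConv, ← this, rlIntegral, ← intervalIntegral.integral_smul]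
  simp only [rlKernel, mul_smul]

lemma integrable_rlKernel {β T : ℝ} (hβ : 0 < β) :
    Integrable (rlKernel β) (timeMeasure T) := by
  have h := (intervalIntegral.intervalIntegrable_rpow' (r := β - 1) (a := 0) (b := T)
    (by linarith)).1
  exact (h.mono_set Ioo_subset_Ioc_self).const_mul _

lemma integral_rpow_mul_rpow {a b t : ℝ} (ha : 0 < a) (hb : 0 < b) (ht : 0 < t) :
    ∫ s in (0 : ℝ)..t, s ^ (a - 1) * (t - s) ^ (b - 1)
      = t ^ (a + b - 1) * ProbabilityTheory.beta a b := by
  have h := Complex.betaIntegral_scaled a b ht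
  have e : ∫ x in (0 : ℝ)..t, (x : ℂ) ^ ((a : ℂ) - 1) * ((t : ℂ) - x) ^ ((b : ℂ) - 1)
      = ((∫ s in (0 : ℝ)..t, s ^ (a - 1) * (t - s) ^ (b - 1) : ℝ) : ℂ) := by
    rw [← intervalIntegral.integral_ofReal]
    refine intervalIntegral.integral_congr fun x hx => ?_
    rw [uIcc_of_le ht.le] at hx
    rw [Complex.ofReal_mul, Complex.ofReal_cpow hx.1, Complex.ofReal_cpow (sub_nonneg.2 hx.2)]
    push_cast
    rfl
  rw [e, Complex.betaIntegral_eq_Gamma_mul_div a b (by simpa) (by simpa)] at h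
  have e2 : (t : ℂ) ^ ((a : ℂ) + b - 1) = ((t ^ (a + b - 1) : ℝ) : ℂ) := by
    rw [Complex.ofReal_cpow ht.le]; push_cast; rfl
  rw [e2, ← Complex.ofReal_add, Complex.Gamma_ofReal, Complex.Gamma_ofReal,
    Complex.Gamma_ofReal] at h
  rw [ProbabilityTheory.beta]
  exact_mod_cast h

/-- The power of `t` in the scaled Beta integral is `α + (1 - α) - 1 = 0`, and `B(α, 1-α) = Γ(α)
Γ(1-α)` cancels the normalising constants. -/
lemma causalConv_rlKernel_rlKernel {α t : ℝ} (h0 : 0 < α) (h1 : α < 1) (ht : 0 < t) :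
    causalConv (rlKernel α) (rlKernel (1 - α)) t = 1 := by
  have h1' : 0 < 1 - α := sub_pos.2 h1
  have h := integral_rpow_mul_rpow h0 h1' ht
  have e : causalConv (rlKernel α) (rlKernel (1 - α)) t
      = ((Real.Gamma α)⁻¹ * (Real.Gamma (1 - α))⁻¹) *
        ∫ s in (0 : ℝ)..t, s ^ (α - 1) * (t - s) ^ ((1 - α) - 1) := by
    rw [causalConv, ← intervalIntegral.integral_const_mul]
    refine intervalIntegral.integral_congr fun s _ => ?_
    simp only [rlKernel, smul_eq_mul]
    ring
  rw [e, h, ProbabilityTheory.beta, add_sub_cancel, sub_self, Real.rpow_zero, Real.Gamma_one]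
  have := (Real.Gamma_pos_of_pos h0).ne'
  have := (Real.Gamma_pos_of_pos h1').ne'
  field_simp

lemma integrableOn_rpow_mul_one_sub_rpow {a b : ℝ} (ha : 0 < a) (hb : 0 < b) :
    IntegrableOn (fun r : ℝ => r ^ (a - 1) * (1 - r) ^ (b - 1)) (Ioo 0 1) := by
  have h := (Complex.betaIntegral_convergent (u := a) (v := b) (by simpa) (by simpa)).1.mono_set
    Ioo_subset_Ioc_self
  refine h.norm.congr ?_
  filter_upwards [ae_restrict_mem measurableSet_Ioo] with r hr
  rw [norm_mul, ← Complex.ofReal_one, ← Complex.ofReal_sub, ← Complex.ofReal_sub,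
    ← Complex.ofReal_sub,
    Complex.norm_cpow_eq_rpow_re_of_pos hr.1, Complex.norm_cpow_eq_rpow_re_of_pos (sub_pos.2 hr.2),
    Complex.ofReal_re, Complex.ofReal_re]

lemma lintegral_eq_mul_lintegral_comp_mul (F : ℝ → ℝ≥0∞) {c : ℝ} (hc : 0 < c) :
    ∫⁻ s, F s = ENNReal.ofReal c * ∫⁻ r, F (c * r) := by
  have h := Real.smul_map_volume_mul_left hc.ne'
  conv_lhs => rw [← h]
  rw [lintegral_smul_measure, abs_of_pos hc,
    (measurableEmbedding_mulLeft₀ hc.ne').lintegral_map]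
  rfl

/-- Substitute `s = t r`: the kernel is homogeneous of degree `α - 1` and `ds = t dr`, which
together produce `t^α` and leave an average of dilates of `y`. -/
lemma enorm_causalConv_rlKernel_le {α t : ℝ} (ht : 0 < t) (y : ℝ → X) :
    ‖causalConv (rlKernel α) y t‖ₑ
      ≤ ENNReal.ofReal (t ^ α) * ∫⁻ r in Ioo 0 1, ‖rlKernel α r‖ₑ * ‖y (t * (1 - r))‖ₑ := by
  rw [causalConv_eq_setIntegral _ _ ht.le]
  refine (enorm_integral_le_lintegral_enorm _).trans (le_of_eq ?_)
  rw [← lintegral_indicator measurableSet_Ioo, lintegral_eq_mul_lintegral_comp_mul _ ht,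
    ← lintegral_indicator measurableSet_Ioo, ← lintegral_const_mul' _ _ ENNReal.ofReal_ne_top,
    ← lintegral_const_mul' _ _ ENNReal.ofReal_ne_top]
  refine lintegral_congr fun r => ?_
  by_cases hr : r ∈ Ioo 0 1
  · have hr' : t * r ∈ Ioo 0 t := ⟨mul_pos ht hr.1, by nlinarith [hr.2]⟩
    rw [indicator_of_mem hr, indicator_of_mem hr', enorm_smul, ← mul_assoc, ← mul_assoc]
    have e1 : t - t * r = t * (1 - r) := by ring
    rw [e1]
    congr 1
    rw [rlKernel, Real.mul_rpow ht.le hr.1.le,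
      show (Real.Gamma α)⁻¹ * (t ^ (α - 1) * r ^ (α - 1)) = t ^ (α - 1) * rlKernel α r by
        rw [rlKernel]; ring, enorm_mul, ← mul_assoc, Real.enorm_of_nonneg (by positivity),
      ← ENNReal.ofReal_mul ht.le]
    congr 2
    rw [Real.rpow_sub_one ht.ne']
    field_simp
  · have hr' : t * r ∉ Ioo 0 t := fun h =>
      hr ⟨(mul_pos_iff_of_pos_left ht).1 h.1, by nlinarith [h.2]⟩
    rw [indicator_of_notMem hr, indicator_of_notMem hr', mul_zero, mul_zero]

/-- Up to the factor `1/Γ(α)` this is the Beta integral `B(α, 1/2)`. -/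
lemma hardyConst_lt_top {α : ℝ} (hα : 0 < α) :
    ∫⁻ r in Ioo (0 : ℝ) 1, ‖rlKernel α r‖ₑ * ENNReal.ofReal ((1 - r) ^ (-(1 / 2) : ℝ)) < ⊤ := by
  have h := ((integrableOn_rpow_mul_one_sub_rpow hα (b := 1 / 2) (by norm_num)).const_mul
    (Real.Gamma α)⁻¹).2
  refine lt_of_le_of_lt (le_of_eq ?_) h
  refine setLIntegral_congr_fun measurableSet_Ioo fun r hr => ?_
  have : 0 < 1 - r := sub_pos.2 hr.2
  simp only
  rw [← mul_assoc, enorm_mul, Real.enorm_of_nonneg (r := (1 - r) ^ _) (by positivity)]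
  norm_num [rlKernel]

/-- Hardy's inequality for the Riemann-Liouville integral, for a measurable function. -/
lemma hardy_rlKernel_aux {α : ℝ} (hα : 0 < α) {y : ℝ → X} (hy : StronglyMeasurable y) (T : ℝ) :
    ∫⁻ t in Ioo 0 T, ‖causalConv (rlKernel α) y t‖ₑ ^ 2 * ENNReal.ofReal (t ^ (-(2 * α)))
      ≤ (∫⁻ r in Ioo (0 : ℝ) 1, ‖rlKernel α r‖ₑ * ENNReal.ofReal ((1 - r) ^ (-(1 / 2) : ℝ))) ^ 2
        * ∫⁻ t, ‖y t‖ₑ ^ 2 := by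
  -- The factor `(1-r)^(-1/2)` is the `L²` norm of the dilation `t ↦ t(1-r)`. It is moved into the
  -- weight `k` and compensated by `p`, whose square `1 - r` cancels the Jacobian.
  set k : ℝ → ℝ≥0∞ := fun r => ‖rlKernel α r‖ₑ * ENNReal.ofReal ((1 - r) ^ (-(1 / 2) : ℝ)) with hk
  set p : ℝ → ℝ≥0∞ := fun r => ENNReal.ofReal ((1 - r) ^ (1 / 2 : ℝ)) with hp
  set B := ∫⁻ r in Ioo (0 : ℝ) 1, k r with hB
  have hBtop : B < ⊤ := hardyConst_lt_top hα
  have hκm : Measurable (rlKernel α) := by unfold rlKernel; fun_prop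
  have hkm : Measurable k := by
    simp only [hk]
    exact hκm.enorm.mul (Measurable.ennreal_ofReal (by fun_prop))
  have hpm : Measurable p := by
    simp only [hp]
    exact Measurable.ennreal_ofReal (by fun_prop)
  have hym : Measurable fun q : ℝ × ℝ => ‖y (q.1 * (1 - q.2))‖ₑ :=
    (hy.comp_measurable (by fun_prop)).enorm
  have hkp : ∀ r ∈ Ioo (0 : ℝ) 1, k r * p r = ‖rlKernel α r‖ₑ := fun r hr => by
    have : 0 < 1 - r := sub_pos.2 hr.2
    simp only [hk, hp]
    rw [mul_assoc, ← ENNReal.ofReal_mul (by positivity), ← Real.rpow_add this]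
    norm_num
  have hpp : ∀ r ∈ Ioo (0 : ℝ) 1, p r ^ 2 = ENNReal.ofReal (1 - r) := fun r hr => by
    have : 0 < 1 - r := sub_pos.2 hr.2
    simp only [hp]
    rw [← ENNReal.ofReal_pow (by positivity), ← Real.rpow_natCast, ← Real.rpow_mul this.le]
    norm_num
  calc ∫⁻ t in Ioo 0 T, ‖causalConv (rlKernel α) y t‖ₑ ^ 2 * ENNReal.ofReal (t ^ (-(2 * α)))
      ≤ ∫⁻ t in Ioo 0 T, B * ∫⁻ r in Ioo (0 : ℝ) 1, k r * (p r * ‖y (t * (1 - r))‖ₑ) ^ 2 := by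
        refine setLIntegral_mono' measurableSet_Ioo fun t ht => ?_
        have h1 := pow_le_pow_left₀ (zero_le) (enorm_causalConv_rlKernel_le (α := α) ht.1 y) 2
        have e : ∫⁻ r in Ioo (0 : ℝ) 1, ‖rlKernel α r‖ₑ * ‖y (t * (1 - r))‖ₑ
            = ∫⁻ r in Ioo (0 : ℝ) 1, k r * (p r * ‖y (t * (1 - r))‖ₑ) :=
          setLIntegral_congr_fun measurableSet_Ioo fun r hr => by
            rw [← mul_assoc, hkp r hr]
        have hm : Measurable fun r => p r * ‖y (t * (1 - r))‖ₑ :=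
          hpm.mul (hy.comp_measurable (by fun_prop)).enorm
        have h2 := sq_lintegral_mul_le (μ := volume.restrict (Ioo (0 : ℝ) 1)) hkm.aemeasurable
          hm.aemeasurable
        rw [mul_pow, e] at h1
        calc _ ≤ _ := mul_le_mul_left h1 _
          _ = (ENNReal.ofReal (t ^ α) ^ 2 * ENNReal.ofReal (t ^ (-(2 * α)))) *
              (∫⁻ r in Ioo (0 : ℝ) 1, k r * (p r * ‖y (t * (1 - r))‖ₑ)) ^ 2 := by ring
          _ ≤ _ := by
            have : ENNReal.ofReal (t ^ α) ^ 2 * ENNReal.ofReal (t ^ (-(2 * α))) = 1 := by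
              have := ht.1
              rw [← ENNReal.ofReal_pow (by positivity), ← ENNReal.ofReal_mul (by positivity),
                ← Real.rpow_natCast, ← Real.rpow_mul this.le, ← Real.rpow_add this]
              simp [mul_comm]
            rw [this, one_mul]
            exact h2
    _ ≤ ∫⁻ t, B * ∫⁻ r in Ioo (0 : ℝ) 1, k r * (p r * ‖y (t * (1 - r))‖ₑ) ^ 2 :=
        setLIntegral_le_lintegral _ _
    _ = B * ∫⁻ t, ∫⁻ r in Ioo (0 : ℝ) 1, k r * (p r * ‖y (t * (1 - r))‖ₑ) ^ 2 :=
        lintegral_const_mul' _ _ hBtop.ne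
    _ = B * ∫⁻ r in Ioo (0 : ℝ) 1, ∫⁻ t, k r * (p r * ‖y (t * (1 - r))‖ₑ) ^ 2 := by
        rw [lintegral_lintegral_swap]
        exact ((hkm.comp measurable_snd).mul
          (((hpm.comp measurable_snd).mul hym).pow_const 2)).aemeasurable
    _ = B * ∫⁻ r in Ioo (0 : ℝ) 1, k r * ∫⁻ t, ‖y t‖ₑ ^ 2 := by
        congr 1
        refine setLIntegral_congr_fun measurableSet_Ioo fun r hr => ?_
        have h1 : 0 < 1 - r := sub_pos.2 hr.2
        have hm : Measurable fun t => ‖y (t * (1 - r))‖ₑ ^ 2 :=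
          ((hy.comp_measurable (by fun_prop : Measurable fun t => t * (1 - r))).enorm).pow_const 2
        simp only [mul_pow]
        rw [lintegral_const_mul _ (hm.const_mul _), lintegral_const_mul _ hm, hpp r hr,
          lintegral_eq_mul_lintegral_comp_mul (fun t => ‖y t‖ₑ ^ 2) h1]
        simp only [mul_comm]
    _ = _ := by
        rw [lintegral_mul_const _ hkm, ← mul_assoc, sq]

/-- Hardy's inequality for the Riemann-Liouville integral. -/
lemma hardy_rlKernel {α T : ℝ} (hα : 0 < α) {y : ℝ → X} (hy : MemLp y 2 (timeMeasure T)) :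
    ∫⁻ t in Ioo 0 T, ‖causalConv (rlKernel α) y t‖ₑ ^ 2 * ENNReal.ofReal (t ^ (-(2 * α))) < ⊤ := by
  set Y := (Ioo 0 T).indicator (hy.1.mk y) with hY
  have hYm : StronglyMeasurable Y := hy.1.stronglyMeasurable_mk.indicator measurableSet_Ioo
  have hyY : y =ᵐ[timeMeasure T] Y := by
    filter_upwards [hy.1.ae_eq_mk, ae_restrict_mem measurableSet_Ioo] with t h ht
    rw [hY, indicator_of_mem ht, h]
  have e : ∫⁻ t in Ioo 0 T, ‖causalConv (rlKernel α) y t‖ₑ ^ 2 * ENNReal.ofReal (t ^ (-(2 * α)))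
      = ∫⁻ t in Ioo 0 T, ‖causalConv (rlKernel α) Y t‖ₑ ^ 2 * ENNReal.ofReal (t ^ (-(2 * α))) :=
    setLIntegral_congr_fun measurableSet_Ioo fun t ht => by
      rw [causalConv_congr ht (ae_eq_refl _) hyY]
  rw [e]
  refine (hardy_rlKernel_aux hα hYm T).trans_lt
    (ENNReal.mul_lt_top (ENNReal.pow_lt_top (hardyConst_lt_top hα)) ?_)
  rw [← eLpNorm_two_sq, hY, eLpNorm_indicator_eq_eLpNorm_restrict measurableSet_Ioo,
    eLpNorm_congr_ae hy.1.ae_eq_mk.symm]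
  exact ENNReal.pow_lt_top hy.2

end Kernel

/-! ### The Gagliardo energy of causal convolutions -/

section Gagliardo

open scoped Convolution

variable {X : Type*} [NormedAddCommGroup X]

/-- The double integral in the Sobolev-Slobodecki norm, over `S × S`. -/
def gagliardo (α : ℝ) (S : Set ℝ) (u : ℝ → X) : ℝ≥0∞ :=
  ∫⁻ s in S, ∫⁻ t in S, ‖u t - u s‖ₑ ^ 2 / ENNReal.ofReal (|t - s| ^ (1 + 2 * α))

lemma slobodeckiNorm_eq (α T : ℝ) (u : ℝ → X) [NormedSpace ℝ X] :
    slobodeckiNorm α T u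
      = (eLpNorm u 2 (timeMeasure T) ^ 2 + gagliardo α (Ioo 0 T) u) ^ (1 / 2 : ℝ) := rfl

lemma gagliardo_congr_ae {α : ℝ} {S : Set ℝ} {u v : ℝ → X} (h : u =ᵐ[volume.restrict S] v) :
    gagliardo α S u = gagliardo α S v := by
  refine lintegral_congr_ae ?_
  filter_upwards [h] with s hs
  refine lintegral_congr_ae ?_
  filter_upwards [h] with t ht
  rw [hs, ht]

lemma slobodeckiNorm_congr_ae [NormedSpace ℝ X] {α T : ℝ} {u v : ℝ → X}
    (h : u =ᵐ[timeMeasure T] v) : slobodeckiNorm α T u = slobodeckiNorm α T v := by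
  rw [slobodeckiNorm_eq, slobodeckiNorm_eq, gagliardo_congr_ae h, eLpNorm_congr_ae h]

lemma measurable_gagliardoKernel (α : ℝ) :
    Measurable fun p : ℝ × ℝ => ENNReal.ofReal (|p.2 - p.1| ^ (1 + 2 * α)) :=
  Measurable.ennreal_ofReal (by fun_prop)

lemma sq_add_le_two_mul (a b : ℝ≥0∞) : (a + b) ^ 2 ≤ 2 * a ^ 2 + 2 * b ^ 2 := by
  have h := ENNReal.rpow_add_le_mul_rpow_add_rpow a b (p := 2) (by norm_num)
  norm_num at h
  rwa [mul_add] at h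

lemma aemeasurable_gagliardo_integrand (α : ℝ) {S : Set ℝ} {u : ℝ → X}
    (hu : AEStronglyMeasurable u (volume.restrict S)) :
    AEMeasurable (fun p : ℝ × ℝ => ‖u p.2 - u p.1‖ₑ ^ 2 / ENNReal.ofReal (|p.2 - p.1| ^ (1 + 2 * α)))
      ((volume.restrict S).prod (volume.restrict S)) :=
  ((hu.comp_snd.sub hu.comp_fst).enorm.pow_const 2).div
    (measurable_gagliardoKernel α).aemeasurable

lemma gagliardo_eq_lintegral_prod (α : ℝ) {S : Set ℝ} {u : ℝ → X}
    (hu : AEStronglyMeasurable u (volume.restrict S)) :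
    gagliardo α S u = ∫⁻ p, ‖u p.2 - u p.1‖ₑ ^ 2 / ENNReal.ofReal (|p.2 - p.1| ^ (1 + 2 * α))
      ∂((volume.restrict S).prod (volume.restrict S)) :=
  (lintegral_prod _ (aemeasurable_gagliardo_integrand α hu)).symm

lemma gagliardo_add_le (α : ℝ) {S : Set ℝ} {u v : ℝ → X}
    (hu : AEStronglyMeasurable u (volume.restrict S))
    (hv : AEStronglyMeasurable v (volume.restrict S)) :
    gagliardo α S (fun t => u t + v t) ≤ 2 * gagliardo α S u + 2 * gagliardo α S v := by
  rw [gagliardo_eq_lintegral_prod α hu, gagliardo_eq_lintegral_prod α hv,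
    gagliardo_eq_lintegral_prod α (u := fun t => u t + v t) (hu.add hv),
    ← lintegral_const_mul' _ _ ENNReal.ofNat_ne_top, ← lintegral_const_mul' _ _ ENNReal.ofNat_ne_top,
    ← lintegral_add_left' ((aemeasurable_gagliardo_integrand α hu).const_mul 2)]
  refine lintegral_mono fun p => ?_
  simp only [div_eq_mul_inv, ← mul_assoc]
  rw [← add_mul]
  gcongr
  refine le_trans (pow_le_pow_left₀ zero_le ?_ 2) (sq_add_le_two_mul _ _)
  rw [add_sub_add_comm]
  exact enorm_add_le _ _

/-- After extension by zero, this is the kernel mass that a positive time `t` sees on the negative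
axis; it produces exactly the Hardy weight `t^(-2α)`. -/
lemma lintegral_Iic_gagliardoKernel {α t : ℝ} (hα : 0 < α) (ht : 0 < t) :
    ∫⁻ s in Iic 0, (ENNReal.ofReal (|t - s| ^ (1 + 2 * α)))⁻¹
      = ENNReal.ofReal (t ^ (-(2 * α)) / (2 * α)) := by
  have e : ∫⁻ s in Iic 0, (ENNReal.ofReal (|t - s| ^ (1 + 2 * α)))⁻¹
      = ∫⁻ ρ in Ici t, ENNReal.ofReal (ρ ^ (-(1 + 2 * α))) := by
    rw [← lintegral_indicator measurableSet_Iic, ← lintegral_indicator measurableSet_Ici,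
      ← lintegral_sub_left_eq_self ((Ici t).indicator _) t]
    refine lintegral_congr fun s => ?_
    by_cases hs : s ∈ Iic 0
    · have hs' : s ≤ 0 := hs
      have h' : t - s ∈ Ici t := by simp only [mem_Ici]; linarith
      have hp : 0 < t - s := by linarith
      rw [indicator_of_mem hs, indicator_of_mem h', abs_of_pos hp, Real.rpow_neg hp.le,
        ENNReal.ofReal_inv_of_pos (by positivity)]
    · have h' : t - s ∉ Ici t := fun h => hs (by simp only [mem_Ici] at h; simp only [mem_Iic]; linarith)
      rw [indicator_of_notMem hs, indicator_of_notMem h']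
  rw [e, setLIntegral_congr Ioi_ae_eq_Ici.symm, ← ofReal_integral_eq_lintegral_ofReal
      (integrableOn_Ioi_rpow_of_lt (by linarith) ht)
      (by filter_upwards [ae_restrict_mem measurableSet_Ioi] with ρ hρ
          exact Real.rpow_nonneg (ht.le.trans (le_of_lt hρ)) _),
    integral_Ioi_rpow_of_lt (by linarith) ht]
  congr 1
  rw [show -(1 + 2 * α) + 1 = -(2 * α) by ring, neg_div_neg_eq]

/-- The Gagliardo energy of the extension by zero. -/
lemma gagliardo_indicator_lt_top {α T : ℝ} (hα : 0 < α) (hT : 0 < T) {v : ℝ → X}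
    (hv : StronglyMeasurable v) (hg : gagliardo α (Ioo 0 T) v < ⊤)
    (hw : ∫⁻ t in Ioo 0 T, ‖v t‖ₑ ^ 2 * ENNReal.ofReal (t ^ (-(2 * α))) < ⊤) :
    gagliardo α (Iio T) ((Ioo 0 T).indicator v) < ⊤ := by
  set V := (Ioo 0 T).indicator v with hV
  have hVm : StronglyMeasurable V := hv.indicator measurableSet_Ioo
  set K : ℝ → ℝ → ℝ≥0∞ := fun s t =>
    ‖V t - V s‖ₑ ^ 2 / ENNReal.ofReal (|t - s| ^ (1 + 2 * α)) with hK
  have hKm : Measurable (Function.uncurry K) :=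
    (((hVm.comp_measurable measurable_snd).sub
      (hVm.comp_measurable measurable_fst)).enorm.pow_const 2).div (measurable_gagliardoKernel α)
  have hU : Iio T = Iic 0 ∪ Ioo 0 T := by
    ext x
    simp only [mem_Iio, mem_union, mem_Iic, mem_Ioo]
    constructor
    · intro h
      by_cases h0 : x ≤ 0
      · exact Or.inl h0
      · exact Or.inr ⟨not_le.1 h0, h⟩
    · rintro (h | h)
      · linarith
      · exact h.2
  have hd : Disjoint (Iic (0 : ℝ)) (Ioo 0 T) :=
    Set.disjoint_left.2 fun x hx hx' => absurd hx'.1 (not_lt.2 hx)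
  have hV0 : ∀ s ∈ Iic (0 : ℝ), V s = 0 := fun s hs =>
    indicator_of_notMem (fun h => absurd h.1 (not_lt.2 hs)) v
  have hV1 : ∀ s ∈ Ioo 0 T, V s = v s := fun s hs => indicator_of_mem hs v
  have hI : ∀ s : ℝ, ∫⁻ t in Iio T, K s t = (∫⁻ t in Iic 0, K s t) + ∫⁻ t in Ioo 0 T, K s t :=
    fun s => by rw [hU, lintegral_union measurableSet_Ioo hd]
  -- Pairs with times of opposite sign contribute the Hardy integral times `1/(2α)`; pairs of
  -- nonpositive times contribute nothing.
  have hmix : ∫⁻ s in Ioo 0 T, ∫⁻ t in Iic 0, K s t < ⊤ := by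
    have : ∀ s ∈ Ioo 0 T, ∫⁻ t in Iic 0, K s t
        = ENNReal.ofReal (2 * α)⁻¹ * (‖v s‖ₑ ^ 2 * ENNReal.ofReal (s ^ (-(2 * α)))) := by
      intro s hs
      have : ∀ t ∈ Iic (0 : ℝ), K s t
          = ‖v s‖ₑ ^ 2 * (ENNReal.ofReal (|s - t| ^ (1 + 2 * α)))⁻¹ := fun t ht => by
        simp only [hK]
        rw [hV0 t ht, hV1 s hs, zero_sub, enorm_neg, abs_sub_comm, div_eq_mul_inv]
      rw [setLIntegral_congr_fun measurableSet_Iic this, lintegral_const_mul' _ _ (by simp),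
        lintegral_Iic_gagliardoKernel hα hs.1, div_eq_mul_inv,
        ENNReal.ofReal_mul (Real.rpow_nonneg hs.1.le _)]
      ring
    rw [setLIntegral_congr_fun measurableSet_Ioo this,
      lintegral_const_mul' _ _ ENNReal.ofReal_ne_top]
    exact ENNReal.mul_lt_top ENNReal.ofReal_lt_top hw
  have hsymm : ∀ s t, K s t = K t s := fun s t => by
    simp only [hK]
    rw [enorm_sub_rev, abs_sub_comm]
  have hmix' : ∫⁻ s in Iic 0, ∫⁻ t in Ioo 0 T, K s t < ⊤ := by
    rw [lintegral_lintegral_swap hKm.aemeasurable]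
    simpa only [hsymm] using hmix
  have h00 : ∫⁻ s in Iic 0, ∫⁻ t in Iic 0, K s t = 0 := by
    have : ∀ s ∈ Iic (0 : ℝ), ∫⁻ t in Iic 0, K s t = 0 := fun s hs => by
      have : ∀ t ∈ Iic (0 : ℝ), K s t = 0 := fun t ht => by
        simp only [hK]
        rw [hV0 t ht, hV0 s hs]
        simp
      rw [setLIntegral_congr_fun measurableSet_Iic this]
      simp
    rw [setLIntegral_congr_fun measurableSet_Iic this]
    simp
  have h11 : ∫⁻ s in Ioo 0 T, ∫⁻ t in Ioo 0 T, K s t = gagliardo α (Ioo 0 T) v :=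
    gagliardo_congr_ae (by filter_upwards [ae_restrict_mem measurableSet_Ioo] with t ht using hV1 t ht)
  have hm : ∀ S : Set ℝ, Measurable fun s => ∫⁻ t in S, K s t := fun S =>
    hKm.lintegral_prod_right'
  change ∫⁻ s in Iio T, ∫⁻ t in Iio T, K s t < ⊤
  simp only [hI]
  rw [hU, lintegral_union measurableSet_Ioo hd, lintegral_add_left (hm _),
    lintegral_add_left (hm _), h00, zero_add, h11]
  exact ENNReal.add_lt_top.2 ⟨hmix', ENNReal.add_lt_top.2 ⟨hmix, hg⟩⟩

variable [NormedSpace ℝ X]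

/-- Once both factors are extended by zero, the domain of integration no longer depends on time, so
the increment falls on `V` alone. -/
lemma enorm_causalConv_sub_le {T s t : ℝ} (hs : s ∈ Ioo 0 T) (ht : t ∈ Ioo 0 T) {u : ℝ → ℝ}
    {V : ℝ → X} (hu : MemLp u 2 (timeMeasure T)) (hV : MemLp V 2 (timeMeasure T)) :
    ‖causalConv u V t - causalConv u V s‖ₑ ≤ ∫⁻ r, ‖(Ioo 0 T).indicator u r‖ₑ *
      ‖(Ioo 0 T).indicator V (t - r) - (Ioo 0 T).indicator V (s - r)‖ₑ := by
  have it := (causalConvExists_iff ht u V).1 (causalConvExists_of_memLp_two ht hu hV)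
  have is := (causalConvExists_iff hs u V).1 (causalConvExists_of_memLp_two hs hu hV)
  rw [causalConv_eq_convolution ht, causalConv_eq_convolution hs, convolution_def,
    convolution_def, ← integral_sub it is]
  refine (enorm_integral_le_lintegral_enorm _).trans (le_of_eq ?_)
  refine lintegral_congr fun r => ?_
  rw [← map_sub, ContinuousLinearMap.lsmul_apply, enorm_smul]

/-- A shift by `r > 0` moves `(0,T)` to the left, hence out of `(0,T)` but never beyond `T`. This is
why the extended energy is taken over `Iio T`. -/
lemma setLIntegral_comp_sub_le {T r : ℝ} (hr : 0 < r) (F : ℝ → ℝ≥0∞) :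
    ∫⁻ s in Ioo 0 T, F (s - r) ≤ ∫⁻ s in Iio T, F s := by
  rw [← lintegral_indicator measurableSet_Ioo, ← lintegral_indicator measurableSet_Iio,
    ← lintegral_sub_right_eq_self ((Iio T).indicator F) r]
  refine lintegral_mono fun s => ?_
  by_cases hs : s ∈ Ioo 0 T
  · have : s - r ∈ Iio T := by simp only [mem_Iio]; linarith [hs.2]
    rw [indicator_of_mem hs, indicator_of_mem this]
  · rw [indicator_of_notMem hs]
    exact zero_le

lemma lintegral_translate_le {T : ℝ} {p : ℝ → ℝ≥0∞} {H : ℝ → ℝ → ℝ≥0∞} (hp : Measurable p)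
    (hptop : ∀ r, p r ≠ ⊤) (hp0 : ∀ r ≤ 0, p r = 0) (hH : Measurable (Function.uncurry H)) :
    ∫⁻ s in Ioo 0 T, ∫⁻ t in Ioo 0 T, ∫⁻ r, p r * H (s - r) (t - r)
      ≤ (∫⁻ r, p r) * ∫⁻ s in Iio T, ∫⁻ t in Iio T, H s t := by
  have hm3 : Measurable fun q : (ℝ × ℝ) × ℝ => p q.2 * H (q.1.1 - q.2) (q.1.2 - q.2) :=
    (hp.comp measurable_snd).mul (hH.comp
      (by fun_prop : Measurable fun q : (ℝ × ℝ) × ℝ => (q.1.1 - q.2, q.1.2 - q.2)))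
  calc ∫⁻ s in Ioo 0 T, ∫⁻ t in Ioo 0 T, ∫⁻ r, p r * H (s - r) (t - r)
      = ∫⁻ s in Ioo 0 T, ∫⁻ r, ∫⁻ t in Ioo 0 T, p r * H (s - r) (t - r) := by
        refine lintegral_congr fun s => ?_
        have h : Measurable (Function.uncurry fun t r => p r * H (s - r) (t - r)) :=
          hm3.comp (by fun_prop : Measurable fun q : ℝ × ℝ => ((s, q.1), q.2))
        exact lintegral_lintegral_swap h.aemeasurable
    _ = ∫⁻ r, ∫⁻ s in Ioo 0 T, ∫⁻ t in Ioo 0 T, p r * H (s - r) (t - r) := by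
        have h : Measurable (Function.uncurry fun s r =>
            ∫⁻ t in Ioo 0 T, p r * H (s - r) (t - r)) :=
          Measurable.lintegral_prod_right' (f := fun q : (ℝ × ℝ) × ℝ =>
            p q.1.2 * H (q.1.1 - q.1.2) (q.2 - q.1.2)) (hm3.comp
            (by fun_prop : Measurable fun q : (ℝ × ℝ) × ℝ => ((q.1.1, q.2), q.1.2)))
        exact lintegral_lintegral_swap h.aemeasurable
    _ ≤ ∫⁻ r, p r * ∫⁻ s in Iio T, ∫⁻ t in Iio T, H s t := by
        refine lintegral_mono fun r => ?_
        by_cases hr : 0 < r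
        · simp only [lintegral_const_mul' _ _ (hptop r)]
          refine mul_le_mul' le_rfl ?_
          refine le_trans ?_ (setLIntegral_comp_sub_le hr fun s => ∫⁻ t in Iio T, H s t)
          exact lintegral_mono fun s => setLIntegral_comp_sub_le hr (H (s - r))
        · simp [hp0 r (not_lt.1 hr)]
    _ = _ := lintegral_mul_const _ hp

/-- Causal convolution with an integrable function is bounded for the Gagliardo energy of the
extension by zero. -/
lemma gagliardo_causalConv_le {α T : ℝ} {u : ℝ → ℝ} {V : ℝ → X}
    (hum : StronglyMeasurable u) (hVm : StronglyMeasurable V)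
    (hu : MemLp u 2 (timeMeasure T)) (hV : MemLp V 2 (timeMeasure T)) :
    gagliardo α (Ioo 0 T) (causalConv u V)
      ≤ (∫⁻ s in Ioo 0 T, ‖u s‖ₑ) ^ 2 * gagliardo α (Iio T) ((Ioo 0 T).indicator V) := by
  have hU'm : Measurable ((Ioo 0 T).indicator u) := hum.measurable.indicator measurableSet_Ioo
  have hV'm : StronglyMeasurable ((Ioo 0 T).indicator V) := hVm.indicator measurableSet_Ioo
  have hNeq : ∫⁻ s in Ioo 0 T, ‖u s‖ₑ = ∫⁻ r, ‖(Ioo 0 T).indicator u r‖ₑ := by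
    rw [← lintegral_indicator measurableSet_Ioo]
    exact lintegral_congr fun r => (enorm_indicator_eq_indicator_enorm ..).symm
  have hNtop : ∫⁻ r, ‖(Ioo 0 T).indicator u r‖ₑ < ⊤ := by
    rw [← hNeq]
    exact (integrable_of_memLp_two hu).2
  have hp0 : ∀ r ≤ 0, ‖(Ioo 0 T).indicator u r‖ₑ = 0 := fun r hr => by
    rw [indicator_of_notMem (fun h => absurd h.1 (not_lt.2 hr)), enorm_zero]
  have hpt : ∀ s ∈ Ioo 0 T, ∀ t ∈ Ioo 0 T,
      ‖causalConv u V t - causalConv u V s‖ₑ ^ 2 / ENNReal.ofReal (|t - s| ^ (1 + 2 * α))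
        ≤ (∫⁻ r, ‖(Ioo 0 T).indicator u r‖ₑ) * ∫⁻ r, ‖(Ioo 0 T).indicator u r‖ₑ *
          (‖(Ioo 0 T).indicator V (t - r) - (Ioo 0 T).indicator V (s - r)‖ₑ ^ 2 /
            ENNReal.ofReal (|(t - r) - (s - r)| ^ (1 + 2 * α))) := by
    intro s hs t ht
    have h1 := enorm_causalConv_sub_le hs ht hu hV
    generalize (Ioo 0 T).indicator V = V' at *
    generalize (Ioo 0 T).indicator u = U' at *
    have hm : Measurable fun r => ‖V' (t - r) - V' (s - r)‖ₑ :=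
      ((hV'm.comp_measurable (by fun_prop : Measurable fun r => t - r)).sub
        (hV'm.comp_measurable (by fun_prop : Measurable fun r => s - r))).enorm
    have h2 := (pow_le_pow_left₀ zero_le h1 2).trans
      (sq_lintegral_mul_le hU'm.enorm.aemeasurable hm.aemeasurable)
    have hm' : Measurable fun r => ‖U' r‖ₑ * ‖V' (t - r) - V' (s - r)‖ₑ ^ 2 :=
      hU'm.enorm.mul (hm.pow_const 2)
    -- The kernel depends only on `t - s`, so it is unchanged for the translated pair and leaves the
    -- `r`-integral.
    simp only [sub_sub_sub_cancel_right, div_eq_mul_inv, ← mul_assoc]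
    rw [lintegral_mul_const _ hm', ← mul_assoc]
    exact mul_le_mul' h2 le_rfl
  have hHm : Measurable (Function.uncurry fun s t =>
      ‖(Ioo 0 T).indicator V t - (Ioo 0 T).indicator V s‖ₑ ^ 2 /
        ENNReal.ofReal (|t - s| ^ (1 + 2 * α))) :=
    (((hV'm.comp_measurable measurable_snd).sub
      (hV'm.comp_measurable measurable_fst)).enorm.pow_const 2).div (measurable_gagliardoKernel α)
  have htr := lintegral_translate_le (T := T) hU'm.enorm (fun _ => enorm_ne_top) hp0 hHm
  rw [hNeq, sq, mul_assoc]
  refine le_trans ?_ (mul_le_mul' le_rfl htr)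
  simp only [← lintegral_const_mul' _ _ hNtop.ne]
  refine setLIntegral_mono' measurableSet_Ioo fun s hs =>
    setLIntegral_mono' measurableSet_Ioo fun t ht => ?_
  rw [lintegral_const_mul' _ _ hNtop.ne]
  exact hpt s hs t ht

end Gagliardo

/-! ### Gagliardo energy of primitives -/

section Primitive

variable {X : Type*} [NormedAddCommGroup X] [NormedSpace ℝ X]

/-- The integrand is `|ρ|^(1-2γ)`, and `1 - 2γ > -1` because `γ < 1`. -/
lemma lintegral_abs_rpow_lt_top {γ T : ℝ} (hγ : γ < 1) :
    ∫⁻ ρ in Ioo (-T) T, ENNReal.ofReal (|ρ| ^ (-(2 * γ))) * ENNReal.ofReal |ρ| < ⊤ := by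
  set φ : ℝ → ℝ≥0∞ := (Ioo 0 T).indicator fun ρ => ENNReal.ofReal (ρ ^ (1 - 2 * γ)) with hφ
  have hφm : Measurable φ :=
    (Measurable.ennreal_ofReal (by fun_prop)).indicator measurableSet_Ioo
  have hφi : ∫⁻ ρ, φ ρ < ⊤ := by
    rw [hφ, lintegral_indicator measurableSet_Ioo]
    have h := ((intervalIntegral.intervalIntegrable_rpow' (r := 1 - 2 * γ) (a := 0) (b := T)
      (by linarith)).1.mono_set Ioo_subset_Ioc_self).2
    refine lt_of_le_of_lt (le_of_eq ?_) h
    refine setLIntegral_congr_fun measurableSet_Ioo fun ρ hρ => ?_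
    rw [Real.enorm_of_nonneg (Real.rpow_nonneg hρ.1.le _)]
  have hpos : ∀ ρ ∈ Ioo 0 T,
      ENNReal.ofReal (|ρ| ^ (-(2 * γ))) * ENNReal.ofReal |ρ| = φ ρ := fun ρ hρ => by
    have := hρ.1
    rw [hφ, indicator_of_mem hρ, abs_of_pos hρ.1, ← ENNReal.ofReal_mul (by positivity),
      ← Real.rpow_add_one hρ.1.ne']
    congr 2
    ring
  calc ∫⁻ ρ in Ioo (-T) T, ENNReal.ofReal (|ρ| ^ (-(2 * γ))) * ENNReal.ofReal |ρ|
      ≤ ∫⁻ ρ in Ioo (-T) T, (φ ρ + φ (-ρ)) := by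
        refine setLIntegral_mono' measurableSet_Ioo fun ρ hρ => ?_
        rcases lt_trichotomy ρ 0 with h | h | h
        · rw [← abs_neg, hpos (-ρ) ⟨by linarith, by linarith [hρ.1]⟩]
          exact le_add_self
        · simp [h]
        · rw [hpos ρ ⟨h, hρ.2⟩]
          exact le_self_add
    _ ≤ ∫⁻ ρ, (φ ρ + φ (-ρ)) := setLIntegral_le_lintegral _ _
    _ = (∫⁻ ρ, φ ρ) + ∫⁻ ρ, φ ρ := by
        rw [lintegral_add_left hφm, lintegral_neg_eq_self]
    _ < ⊤ := ENNReal.add_lt_top.2 ⟨hφi, hφi⟩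

/-- Cauchy–Schwarz on the interval between `s` and `s + ρ`. Membership in it is recorded as a
function of `s - r`, so that integrating in `s` later becomes a translation-invariant integral. -/
lemma sq_enorm_intervalIntegral_le {s ρ : ℝ} {U : ℝ → ℝ} (hU : Measurable U) :
    ‖∫ r in s..(s + ρ), U r‖ₑ ^ 2 ≤ ENNReal.ofReal |ρ| *
      ∫⁻ r, (uIcc (-ρ) 0).indicator (fun _ => 1) (s - r) * ‖U r‖ₑ ^ 2 := by
  have h1 : ‖∫ r in s..(s + ρ), U r‖ₑ ≤ ∫⁻ r in uIoc s (s + ρ), 1 * ‖U r‖ₑ := by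
    simp only [one_mul]
    rw [← ofReal_norm, intervalIntegral.norm_integral_eq_norm_integral_uIoc,
      ofReal_norm]
    exact enorm_integral_le_lintegral_enorm _
  have h2 := sq_lintegral_mul_le (μ := volume.restrict (uIoc s (s + ρ))) (k := fun _ => 1)
    aemeasurable_const hU.enorm.aemeasurable
  refine (pow_le_pow_left₀ zero_le h1 2).trans (h2.trans ?_)
  refine mul_le_mul' (by simp [Real.volume_uIoc]) ?_
  rw [← lintegral_indicator measurableSet_uIoc]
  refine lintegral_mono fun r => ?_
  by_cases hr : r ∈ uIoc s (s + ρ)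
  · have : s - r ∈ uIcc (-ρ) 0 := by
      rw [mem_uIoc] at hr
      rw [mem_uIcc]
      rcases hr with h | h
      · left; constructor <;> linarith [h.1, h.2]
      · right; constructor <;> linarith [h.1, h.2]
    rw [indicator_of_mem hr, indicator_of_mem this]
  · rw [indicator_of_notMem hr]
    exact zero_le

/-- With `ρ = t - s`, the squared increment integrated over `s` is at most `ρ² ‖U‖₂² ‖f‖²`; division
by `|ρ|^(1+2α)` leaves `|ρ|^(1-2α)`. -/
lemma gagliardo_primitive_le {α T : ℝ} {U : ℝ → ℝ} (hU : Measurable U)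
    (hUi : ∀ a b, IntervalIntegrable U volume a b) (f : X) :
    gagliardo α (Ioo 0 T) (fun t => (∫ r in (0 : ℝ)..t, U r) • f) ≤
      (‖f‖ₑ ^ 2 * ∫⁻ ρ in Ioo (-T) T, ENNReal.ofReal (|ρ| ^ (-(2 * α))) * ENNReal.ofReal |ρ|) *
        ∫⁻ r, ‖U r‖ₑ ^ 2 := by
  set I : ℝ → ℝ → ℝ≥0∞ := fun ρ => (uIcc (-ρ) 0).indicator fun _ => 1 with hI
  have hIm : Measurable (Function.uncurry I) := by
    have e : Function.uncurry I = indicator {p : ℝ × ℝ | min (-p.1) 0 ≤ p.2 ∧ p.2 ≤ max (-p.1) 0}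
        (fun _ => 1) := by
      ext p
      simp only [Function.uncurry, hI, indicator, uIcc, mem_Icc, mem_ofPred_eq]
    rw [e]
    have hS : MeasurableSet {p : ℝ × ℝ | min (-p.1) 0 ≤ p.2 ∧ p.2 ≤ max (-p.1) 0} :=
      MeasurableSet.inter (s₁ := {p : ℝ × ℝ | min (-p.1) 0 ≤ p.2})
        (s₂ := {p : ℝ × ℝ | p.2 ≤ max (-p.1) 0})
        (measurableSet_le (by fun_prop) (by fun_prop))
        (measurableSet_le (by fun_prop) (by fun_prop))
    exact measurable_const.indicator hS
  have hG : ∀ ρ : ℝ, ∫⁻ s, ∫⁻ r, I ρ (s - r) * ‖U r‖ₑ ^ 2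
      = ENNReal.ofReal |ρ| * ∫⁻ r, ‖U r‖ₑ ^ 2 := by
    intro ρ
    have hIρ : Measurable (I ρ) := hIm.comp (by fun_prop : Measurable fun x : ℝ => (ρ, x))
    have h : Measurable (Function.uncurry fun s r => I ρ (s - r) * ‖U r‖ₑ ^ 2) :=
      (hIρ.comp (by fun_prop : Measurable fun q : ℝ × ℝ => q.1 - q.2)).mul
        ((hU.comp measurable_snd).enorm.pow_const 2)
    rw [lintegral_lintegral_swap h.aemeasurable, ← lintegral_const_mul _ (hU.enorm.pow_const 2)]
    refine lintegral_congr fun r => ?_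
    have hIr : Measurable fun s => I ρ (s - r) :=
      hIρ.comp (by fun_prop : Measurable fun s : ℝ => s - r)
    rw [lintegral_mul_const _ hIr]
    congr 1
    rw [lintegral_sub_right_eq_self (I ρ) r, hI]
    simp only
    rw [lintegral_indicator measurableSet_uIcc]
    simp
  have hpt : ∀ s t : ℝ, ‖(∫ r in (0 : ℝ)..t, U r) • f - (∫ r in (0 : ℝ)..s, U r) • f‖ₑ ^ 2 /
      ENNReal.ofReal (|t - s| ^ (1 + 2 * α)) ≤ ‖f‖ₑ ^ 2 *
        (ENNReal.ofReal (|t - s| ^ (-(2 * α))) * ∫⁻ r, I (t - s) (s - r) * ‖U r‖ₑ ^ 2) := by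
    intro s t
    rcases eq_or_ne t s with rfl | hts
    · simp
    have hp : 0 < |t - s| := abs_pos.2 (sub_ne_zero.2 hts)
    have h := sq_enorm_intervalIntegral_le (s := s) (ρ := t - s) hU
    rw [add_sub_cancel] at h
    rw [← sub_smul, intervalIntegral.integral_interval_sub_left (hUi _ _) (hUi _ _), enorm_smul,
      mul_pow, div_eq_mul_inv]
    calc _ ≤ _ := mul_le_mul' (mul_le_mul' h le_rfl) le_rfl
      _ = ‖f‖ₑ ^ 2 * ((ENNReal.ofReal |t - s| * (ENNReal.ofReal (|t - s| ^ (1 + 2 * α)))⁻¹) *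
          ∫⁻ r, I (t - s) (s - r) * ‖U r‖ₑ ^ 2) := by ring
      _ = _ := by
        rw [← ENNReal.ofReal_inv_of_pos (by positivity), ← ENNReal.ofReal_mul hp.le,
          ← Real.rpow_neg hp.le, mul_comm |t - s|, ← Real.rpow_add_one hp.ne']
        congr 4
        ring
  set k : ℝ → ℝ≥0∞ := fun ρ => ENNReal.ofReal (|ρ| ^ (-(2 * α))) with hk
  have hkm : Measurable k := Measurable.ennreal_ofReal (by fun_prop)
  have hJm : Measurable (Function.uncurry fun s ρ => k ρ * ∫⁻ r, I ρ (s - r) * ‖U r‖ₑ ^ 2) := by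
    refine (hkm.comp measurable_snd).mul ?_
    exact Measurable.lintegral_prod_right' (f := fun q : (ℝ × ℝ) × ℝ =>
      I q.1.2 (q.1.1 - q.2) * ‖U q.2‖ₑ ^ 2)
      ((hIm.comp (by fun_prop : Measurable fun q : (ℝ × ℝ) × ℝ => (q.1.2, q.1.1 - q.2))).mul
        ((hU.comp measurable_snd).enorm.pow_const 2))
  calc gagliardo α (Ioo 0 T) (fun t => (∫ r in (0 : ℝ)..t, U r) • f)
      ≤ ∫⁻ s in Ioo 0 T, ∫⁻ ρ in Ioo (-T) T,
          ‖f‖ₑ ^ 2 * (k ρ * ∫⁻ r, I ρ (s - r) * ‖U r‖ₑ ^ 2) := by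
        refine setLIntegral_mono' measurableSet_Ioo fun s hs => ?_
        refine (lintegral_mono fun t => hpt s t).trans ?_
        rw [← lintegral_indicator measurableSet_Ioo, ← lintegral_indicator measurableSet_Ioo,
          ← lintegral_sub_right_eq_self ((Ioo (-T) T).indicator _) s]
        refine lintegral_mono fun t => ?_
        by_cases ht : t ∈ Ioo 0 T
        · have : t - s ∈ Ioo (-T) T := ⟨by linarith [ht.1, hs.2], by linarith [ht.2, hs.1]⟩
          rw [indicator_of_mem ht, indicator_of_mem this]
        · rw [indicator_of_notMem ht]
          exact zero_le
    _ ≤ ∫⁻ s, ∫⁻ ρ in Ioo (-T) T, ‖f‖ₑ ^ 2 * (k ρ * ∫⁻ r, I ρ (s - r) * ‖U r‖ₑ ^ 2) :=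
        setLIntegral_le_lintegral _ _
    _ = ‖f‖ₑ ^ 2 * ∫⁻ s, ∫⁻ ρ in Ioo (-T) T, k ρ * ∫⁻ r, I ρ (s - r) * ‖U r‖ₑ ^ 2 := by
        simp only [lintegral_const_mul' _ _ (ENNReal.pow_ne_top (enorm_ne_top (x := f)))]
    _ = ‖f‖ₑ ^ 2 * ∫⁻ ρ in Ioo (-T) T, k ρ * (ENNReal.ofReal |ρ| * ∫⁻ r, ‖U r‖ₑ ^ 2) := by
        rw [lintegral_lintegral_swap hJm.aemeasurable]
        simp only [hk, lintegral_const_mul' _ _ ENNReal.ofReal_ne_top, hG]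
    _ = _ := by
        simp only [← mul_assoc]
        have hkr : Measurable fun ρ : ℝ => k ρ * ENNReal.ofReal |ρ| :=
          hkm.mul (Measurable.ennreal_ofReal (by fun_prop))
        rw [lintegral_mul_const _ hkr, ← mul_assoc]

end Primitive

/-! ### Approximation in `L²(0,T)` by `C¹` functions vanishing for nonpositive times -/

section Density

lemma exists_smooth_approx {T : ℝ} {g : ℝ → ℝ} (hg : MemLp g 2 (timeMeasure T)) {δ : ℝ}
    (hδ : 0 < δ) :
    ∃ G : ℝ → ℝ, HasCompactSupport G ∧ ContDiff ℝ 1 G ∧ (∀ s ≤ 0, G s = 0) ∧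
      eLpNorm (fun s => g s - G s) 2 (timeMeasure T) ≤ ENNReal.ofReal δ := by
  obtain ⟨F, hFc, hFs, hF⟩ := hg.exist_eLpNorm_sub_le (by norm_num) (by norm_num) (half_pos hδ)
  obtain ⟨M, hM⟩ := hFc.exists_bound_of_continuous hFs.continuous
  obtain ⟨η, hη0, hη⟩ := exists_eLpNorm_indicator_le (μ := timeMeasure T) (p := 2) (by norm_num) M
    (ε := ENNReal.ofReal (δ / 2)) (by simpa using hδ)
  -- `χ` is `0` for `s ≤ η/2` and `1` for `s ≥ η`. Cutting off changes `F`, bounded by `M`, only on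
  -- a set of measure at most `η`, which costs at most `δ/2` in `L²`.
  set χ : ℝ → ℝ := fun s => Real.smoothTransition (2 / η * s - 1) with hχ
  have hη' : (0 : ℝ) < η := hη0
  have hχs : ContDiff ℝ ∞ χ :=
    Real.smoothTransition.contDiff.comp ((contDiff_const.mul contDiff_id).sub contDiff_const)
  refine ⟨fun s => χ s * F s, hFc.mul_left, (hχs.mul hFs).of_le (by simp), fun s hs => ?_, ?_⟩
  · have : χ s = 0 := by
      refine Real.smoothTransition.zero_of_nonpos ?_
      have := mul_nonpos_of_nonneg_of_nonpos (by positivity : (0 : ℝ) ≤ 2 / η) hs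
      linarith
    simp [this]
  · have hb : eLpNorm (fun s => F s - χ s * F s) 2 (timeMeasure T) ≤ ENNReal.ofReal (δ / 2) := by
      refine le_trans (eLpNorm_mono (g := (Iio (η : ℝ)).indicator fun _ => M) fun s => ?_)
        (hη (Iio η) ?_)
      · by_cases hs : s < η
        · rw [indicator_of_mem (show s ∈ Iio (η : ℝ) from hs)]
          have h0 := Real.smoothTransition.nonneg (2 / η * s - 1)
          have h1 := Real.smoothTransition.le_one (2 / η * s - 1)
          have e : F s - χ s * F s = (1 - χ s) * F s := by ring
          rw [e, norm_mul]
          have : ‖1 - χ s‖ ≤ 1 := by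
            rw [Real.norm_of_nonneg (by simp only [hχ]; linarith)]
            simp only [hχ]; linarith
          calc _ ≤ 1 * M := mul_le_mul this (hM s) (norm_nonneg _) zero_le_one
            _ ≤ ‖M‖ := by rw [one_mul]; exact le_abs_self M
        · have : χ s = 1 := by
            refine Real.smoothTransition.one_of_one_le ?_
            have h2 : 2 / (η : ℝ) * η ≤ 2 / η * s :=
              mul_le_mul_of_nonneg_left (not_lt.1 hs) (by positivity)
            rw [div_mul_cancel₀ _ hη'.ne'] at h2
            linarith
          simp [this]
      · rw [Measure.restrict_apply measurableSet_Iio]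
        calc volume (Iio (η : ℝ) ∩ Ioo 0 T) ≤ volume (Ioo 0 (η : ℝ)) :=
              measure_mono fun x hx => ⟨hx.2.1, hx.1⟩
          _ = η := by simp
    have hFm : AEStronglyMeasurable F (timeMeasure T) := hFs.continuous.aestronglyMeasurable
    have hχm : AEStronglyMeasurable (fun s => χ s * F s) (timeMeasure T) :=
      (hχs.continuous.mul hFs.continuous).aestronglyMeasurable
    have e : (fun s => g s - χ s * F s) = (g - F) + fun s => F s - χ s * F s := by
      ext s; simp
    rw [e]
    refine (eLpNorm_add_le (hg.1.sub hFm) (hFm.sub hχm) (by norm_num)).trans ?_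
    refine (add_le_add hF hb).trans (le_of_eq ?_)
    rw [← ENNReal.ofReal_add (by positivity) (by positivity), add_halves]

end Density

/-! ### Membership of causal convolutions in `_αH(0,T;X)` -/

section Domain

open scoped Convolution

variable {X : Type*} [NormedAddCommGroup X] [NormedSpace ℝ X]

/-- All regularity comes from `G`, so `Z` need only be integrable. At time `0` the factors `G(r)`
and `Z(-r)` are never both nonzero. -/
lemma zeroC1_convolution {T : ℝ} {G : ℝ → ℝ} (hGc : HasCompactSupport G) (hG : ContDiff ℝ 1 G)
    (hG0 : ∀ s ≤ 0, G s = 0) {Z : ℝ → X} (hZ : Integrable Z (timeMeasure T)) :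
    (G ⋆ (Ioo 0 T).indicator Z) ∈ zeroC1 (X := X) T := by
  have hZ' := (integrable_indicator_iff measurableSet_Ioo).2 hZ
  refine ⟨(hGc.contDiff_convolution_left _ hG hZ'.locallyIntegrable).contDiffOn, ?_⟩
  rw [convolution_lsmul]
  refine integral_eq_zero_of_ae (Eventually.of_forall fun r => ?_)
  by_cases h0 : 0 < r
  · have : 0 - r ∉ Ioo 0 T := fun h' => by linarith [h'.1]
    simp only [indicator_of_notMem this, smul_zero, Pi.zero_apply]
  · simp only [hG0 r (not_lt.1 h0), zero_smul, Pi.zero_apply]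

variable [CompleteSpace X]

/-- The two summands need different arguments: `V` has an extension by zero of finite energy, while
`u * f` is the primitive of `u` times `f`. -/
lemma gagliardo_causalConv_bound {α T : ℝ} (hα0 : 0 < α) (hα1 : α < 1) (hT : 0 < T) {V : ℝ → X}
    (hVm : StronglyMeasurable V) (hV : MemLp V 2 (timeMeasure T))
    (hVg : gagliardo α (Ioo 0 T) V < ⊤)
    (hVw : ∫⁻ t in Ioo 0 T, ‖V t‖ₑ ^ 2 * ENNReal.ofReal (t ^ (-(2 * α))) < ⊤) (f : X) :
    ∃ C : ℝ≥0∞, C < ⊤ ∧ ∀ u : ℝ → ℝ, StronglyMeasurable u → MemLp u 2 (timeMeasure T) →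
      gagliardo α (Ioo 0 T) (causalConv u (fun t => V t + f))
        ≤ C * eLpNorm u 2 (timeMeasure T) ^ 2 := by
  have hE := gagliardo_indicator_lt_top hα0 hT hVm hVg hVw
  set E := gagliardo α (Iio T) ((Ioo 0 T).indicator V)
  have hP := lintegral_abs_rpow_lt_top (T := T) hα1
  set P := ∫⁻ ρ in Ioo (-T) T, ENNReal.ofReal (|ρ| ^ (-(2 * α))) * ENNReal.ofReal |ρ|
  refine ⟨2 * (ENNReal.ofReal T * E) + 2 * (‖f‖ₑ ^ 2 * P), ?_, fun u hum hu => ?_⟩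
  · exact ENNReal.add_lt_top.2 ⟨ENNReal.mul_lt_top (by simp)
      (ENNReal.mul_lt_top ENNReal.ofReal_lt_top hE), ENNReal.mul_lt_top (by simp)
      (ENNReal.mul_lt_top (by simp) hP)⟩
  have hf : MemLp (fun _ : ℝ => f) 2 (timeMeasure T) := memLp_const f
  have hsplit : ∀ t ∈ Ioo 0 T, causalConv u (fun t => V t + f) t
      = causalConv u V t + (∫ r in (0 : ℝ)..t, (Ioo 0 T).indicator u r) • f := fun t ht => by
    rw [CausalConvExists.add_right ht.1.le (causalConvExists_of_memLp_two ht hu hV)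
      (causalConvExists_of_memLp_two ht hu hf)]
    congr 1
    rw [causalConv, intervalIntegral.integral_smul_const]
    congr 1
    rw [intervalIntegral.integral_of_le ht.1.le, intervalIntegral.integral_of_le ht.1.le]
    refine setIntegral_congr_fun measurableSet_Ioc fun r hr => ?_
    exact (indicator_of_mem (show r ∈ Ioo 0 T from ⟨hr.1, hr.2.trans_lt ht.2⟩) u).symm
  have hui : Integrable ((Ioo 0 T).indicator u) :=
    (integrable_indicator_iff measurableSet_Ioo).2 (integrable_of_memLp_two hu)
  have hUi : ∀ a b, IntervalIntegrable ((Ioo 0 T).indicator u) volume a b := fun a b =>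
    hui.intervalIntegrable
  have hm2 : AEStronglyMeasurable
      (fun t => (∫ r in (0 : ℝ)..t, (Ioo 0 T).indicator u r) • f) (timeMeasure T) :=
    ((intervalIntegral.continuous_primitive hUi 0).smul continuous_const).aestronglyMeasurable
  have hm1 := (memLp_causalConv_of_memLp_two hu hV).1
  rw [gagliardo_congr_ae (by
    filter_upwards [ae_restrict_mem measurableSet_Ioo] with t ht using hsplit t ht)]
  refine (gagliardo_add_le α hm1 hm2).trans ?_
  have h1 : gagliardo α (Ioo 0 T) (causalConv u V)
      ≤ (ENNReal.ofReal T * E) * eLpNorm u 2 (timeMeasure T) ^ 2 := by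
    refine (gagliardo_causalConv_le hum hVm hu hV).trans ?_
    -- With weight `1` on `(0,T)` this reads `‖u‖₁² ≤ T ‖u‖₂²`, the source of the factor `T`.
    have h := sq_lintegral_mul_le (μ := timeMeasure T) (k := fun _ => 1) (F := fun s => ‖u s‖ₑ)
      aemeasurable_const hu.1.enorm
    simp only [one_mul] at h
    rw [← eLpNorm_two_sq] at h
    refine (mul_le_mul' h le_rfl).trans (le_of_eq ?_)
    simp only [lintegral_const, Measure.restrict_apply MeasurableSet.univ, univ_inter,
      Real.volume_Ioo, sub_zero, one_mul]
    change _ * E = _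
    ring
  have h2 := gagliardo_primitive_le (α := α) (T := T)
    (hum.measurable.indicator measurableSet_Ioo) hUi f
  rw [← eLpNorm_two_sq, eLpNorm_indicator_eq_eLpNorm_restrict measurableSet_Ioo] at h2
  calc _ ≤ _ := add_le_add (mul_le_mul' le_rfl h1) (mul_le_mul' le_rfl h2)
    _ = _ := by ring

lemma slobodeckiNorm_causalConv_bound {α T : ℝ} (hα0 : 0 < α) (hα1 : α < 1) (hT : 0 < T)
    {V : ℝ → X} (hV : MemLp V 2 (timeMeasure T)) (hVg : gagliardo α (Ioo 0 T) V < ⊤)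
    (hVw : ∫⁻ t in Ioo 0 T, ‖V t‖ₑ ^ 2 * ENNReal.ofReal (t ^ (-(2 * α))) < ⊤) (f : X) :
    ∃ C : ℝ≥0∞, C < ⊤ ∧ ∀ u : ℝ → ℝ, MemLp u 2 (timeMeasure T) →
      slobodeckiNorm α T (causalConv u (fun t => V t + f)) ≤ C * eLpNorm u 2 (timeMeasure T) := by
  have hVW := hV.1.ae_eq_mk
  have hWm := hV.1.stronglyMeasurable_mk
  set W := hV.1.mk V
  have hW : MemLp W 2 (timeMeasure T) := hV.ae_eq hVW
  have hWg : gagliardo α (Ioo 0 T) W < ⊤ := by rwa [← gagliardo_congr_ae hVW]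
  have hWw : ∫⁻ t in Ioo 0 T, ‖W t‖ₑ ^ 2 * ENNReal.ofReal (t ^ (-(2 * α))) < ⊤ := by
    refine lt_of_le_of_lt (le_of_eq (lintegral_congr_ae ?_)) hVw
    filter_upwards [hVW] with t ht
    rw [ht]
  obtain ⟨C, hC, hb⟩ := gagliardo_causalConv_bound hα0 hα1 hT hWm hW hWg hWw f
  have hWf : MemLp (fun t => W t + f) 2 (timeMeasure T) := hW.add (memLp_const f)
  set D := eLpNorm (fun t => W t + f) 2 (timeMeasure T) ^ 2 * ENNReal.ofReal T + C with hD
  refine ⟨D ^ (1 / 2 : ℝ), ?_, fun u hu => ?_⟩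
  · refine ENNReal.rpow_lt_top_of_nonneg (by norm_num) (ne_of_lt (ENNReal.add_lt_top.2 ⟨?_, hC⟩))
    exact ENNReal.mul_lt_top (ENNReal.pow_lt_top hWf.2) ENNReal.ofReal_lt_top
  have hum := hu.1.stronglyMeasurable_mk
  have huu := hu.1.ae_eq_mk
  set u' := hu.1.mk u
  have hu' : MemLp u' 2 (timeMeasure T) := hu.ae_eq huu
  have e : causalConv u (fun t => V t + f) =ᵐ[timeMeasure T] causalConv u' (fun t => W t + f) := by
    filter_upwards [ae_restrict_mem measurableSet_Ioo] with t ht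
    refine causalConv_congr ht huu ?_
    filter_upwards [hVW] with t ht
    rw [ht]
  rw [slobodeckiNorm_congr_ae e, eLpNorm_congr_ae huu, slobodeckiNorm_eq]
  have h1 : eLpNorm (causalConv u' (fun t => W t + f)) 2 (timeMeasure T) ^ 2
      ≤ (eLpNorm (fun t => W t + f) 2 (timeMeasure T) ^ 2 * ENNReal.ofReal T) *
        eLpNorm u' 2 (timeMeasure T) ^ 2 := by
    rw [eLpNorm_two_sq (μ := timeMeasure T) (u := causalConv u' (fun t => W t + f))]
    calc _ ≤ ∫⁻ t in Ioo 0 T, (eLpNorm u' 2 (timeMeasure T) *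
            eLpNorm (fun t => W t + f) 2 (timeMeasure T)) ^ 2 :=
          setLIntegral_mono' measurableSet_Ioo fun t ht =>
            pow_le_pow_left₀ zero_le (enorm_causalConv_le ht hu' hWf) 2
      _ = _ := by
          simp only [lintegral_const, Measure.restrict_apply MeasurableSet.univ, univ_inter,
            Real.volume_Ioo, sub_zero]
          ring
  have e2 : ∀ x : ℝ≥0∞, (x ^ 2) ^ (1 / 2 : ℝ) = x := fun x => by
    rw [← ENNReal.rpow_natCast, ← ENNReal.rpow_mul]; norm_num
  calc _ ≤ (D * eLpNorm u' 2 (timeMeasure T) ^ 2) ^ (1 / 2 : ℝ) := by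
        refine ENNReal.rpow_le_rpow ?_ (by norm_num)
        rw [hD, add_mul]
        exact add_le_add h1 (hb u' hum hu')
    _ = _ := by
        rw [ENNReal.mul_rpow_of_nonneg _ _ (by norm_num), e2]

/-- `u ↦ u * (V + f)` is linear and bounded from `L²` to `H^α`, and it maps a dense set of `u` into
`zeroC1 T`, hence all of `L²` into the closure. -/
lemma mem_zeroFracSobolev_causalConv {α T : ℝ} (hα0 : 0 < α) (hα1 : α < 1) (hT : 0 < T)
    {V : ℝ → X} (hV : MemLp V 2 (timeMeasure T)) (hVg : gagliardo α (Ioo 0 T) V < ⊤)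
    (hVw : ∫⁻ t in Ioo 0 T, ‖V t‖ₑ ^ 2 * ENNReal.ofReal (t ^ (-(2 * α))) < ⊤) (f : X)
    {g : ℝ → ℝ} (hg : MemLp g 2 (timeMeasure T)) :
    causalConv g (fun t => V t + f) ∈ zeroFracSobolev α T := by
  obtain ⟨C, hC, hb⟩ := slobodeckiNorm_causalConv_bound hα0 hα1 hT hV hVg hVw f
  have hZ : MemLp (fun t => V t + f) 2 (timeMeasure T) := hV.add (memLp_const f)
  refine ⟨⟨memLp_causalConv_of_memLp_two hg hZ,
    (hb g hg).trans_lt (ENNReal.mul_lt_top hC hg.2)⟩, fun ε hε => ?_⟩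
  obtain ⟨δ, hδ, hδε⟩ := ENNReal.exists_nnreal_pos_mul_lt hC.ne hε.ne'
  obtain ⟨G, hGc, hG, hG0, hGg⟩ := exists_smooth_approx hg (δ := δ) hδ
  refine ⟨_, zeroC1_convolution hGc hG hG0 (integrable_of_memLp_two hZ), ?_⟩
  have hGL : MemLp G 2 (timeMeasure T) := (hG.continuous.memLp_of_hasCompactSupport hGc)
  have e : (fun t => causalConv g (fun t => V t + f) t
      - (G ⋆ (Ioo 0 T).indicator (fun t => V t + f)) t)
      =ᵐ[timeMeasure T] causalConv (fun s => g s - G s) (fun t => V t + f) := by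
    filter_upwards [ae_restrict_mem measurableSet_Ioo] with t ht
    rw [CausalConvExists.sub_left ht.1.le (causalConvExists_of_memLp_two ht hg hZ)
      (causalConvExists_of_memLp_two ht hGL hZ)]
    congr 1
    exact (causalConv_eq_convolution_of_eqOn ht (fun _ _ => rfl) hG0
      (fun s hs => indicator_of_mem hs _)
      (fun s hs => indicator_of_notMem (fun h' => absurd h'.1 (not_lt.2 hs)) _)).symm
  rw [slobodeckiNorm_congr_ae e]
  refine (hb _ (hg.sub hGL)).trans_lt (lt_of_le_of_lt ?_ hδε)
  rw [mul_comm]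
  refine mul_le_mul' (hGg.trans ?_) le_rfl
  simp

end Domain

/-! ### Weak derivatives and the elliptic operator on `H²(Ω) ∩ H¹₀(Ω)` -/

section Weak

open scoped Convolution

variable {d : ℕ} {Ω : Set (EuclideanSpace ℝ (Fin d))}

/-- The functional `u ↦ ∫ u ψ` on `L²(Ω)`. -/
def pairing {ψ : EuclideanSpace ℝ (Fin d) → ℝ} (hψ : MemLp ψ 2 (volume.restrict Ω)) :
    L2 Ω →L[ℝ] ℝ := innerSL ℝ (hψ.toLp ψ)

lemma pairing_apply {ψ : EuclideanSpace ℝ (Fin d) → ℝ} (hψ : MemLp ψ 2 (volume.restrict Ω))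
    (u : L2 Ω) : pairing hψ u = ∫ x in Ω, u x * ψ x := by
  rw [pairing, innerSL_apply_apply, L2.inner_def]
  refine integral_congr_ae ?_
  filter_upwards [hψ.coeFn_toLp] with x hx
  rw [hx]
  simp

lemma IsTest.memLp {φ : EuclideanSpace ℝ (Fin d) → ℝ} (hφ : IsTest Ω φ) :
    MemLp φ 2 (volume.restrict Ω) :=
  (hφ.smooth.continuous.memLp_of_hasCompactSupport hφ.compact).restrict Ω

lemma IsTest.memLp_pderiv {φ : EuclideanSpace ℝ (Fin d) → ℝ} (hφ : IsTest Ω φ) (i : Fin d) :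
    MemLp (pderiv i φ) 2 (volume.restrict Ω) :=
  ((hφ.continuous_pderiv i).memLp_of_hasCompactSupport (hφ.hasCompactSupport_pderiv i)).restrict Ω

/-- Each test function imposes an equality between two continuous functions of `y`. -/
lemma isClosed_hasWeakPartial {Y : Type*} [TopologicalSpace Y] {i : Fin d} {u h : Y → L2 Ω}
    (hu : Continuous u) (hh : Continuous h) :
    IsClosed {y | HasWeakPartial Ω i (u y) (h y)} := by
  have : {y | HasWeakPartial Ω i (u y) (h y)} =
      ⋂ (φ : EuclideanSpace ℝ (Fin d) → ℝ) (hφ : IsTest Ω φ),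
        {y | pairing (hφ.memLp_pderiv i) (u y) = -pairing hφ.memLp (h y)} := by
    ext y
    simp only [HasWeakPartial, mem_iInter, mem_ofPred_eq, pairing_apply]
  rw [this]
  exact isClosed_iInter fun φ => isClosed_iInter fun hφ =>
    isClosed_eq ((pairing _).continuous.comp hu) ((pairing _).continuous.comp hh).neg

/-- The entry of a second order jet that represents the function or a first derivative. -/
def jetFst (Ω : Set (EuclideanSpace ℝ (Fin d))) (o : Option (Fin d)) : Jet2 Ω →L[ℝ] L2 Ω :=
  (PiLp.proj 2 (fun _ : Option (Fin d) => L2 Ω) o).comp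
    (WithLp.fstL 2 ℝ (Jet1 Ω) (PiLp 2 (fun _ : Fin d × Fin d => L2 Ω)))

/-- The entry of a second order jet that represents the derivative `∂_j ∂_i`. -/
def jetSnd (Ω : Set (EuclideanSpace ℝ (Fin d))) (q : Fin d × Fin d) : Jet2 Ω →L[ℝ] L2 Ω :=
  (PiLp.proj 2 (fun _ : Fin d × Fin d => L2 Ω) q).comp
    (WithLp.sndL 2 ℝ (Jet1 Ω) (PiLp 2 (fun _ : Fin d × Fin d => L2 Ω)))

lemma jetFst_apply (o : Option (Fin d)) (U : Jet2 Ω) : jetFst Ω o U = U.fst o := rfl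

lemma jetSnd_apply (q : Fin d × Fin d) (U : Jet2 Ω) : jetSnd Ω q U = U.snd q := rfl

/-- Closedness gives completeness, which lets Bochner integrals be formed in `H2H10 Ω` itself and
commute with bounded maps out of it. -/
lemma isClosed_H2H10 (Ω : Set (EuclideanSpace ℝ (Fin d))) :
    IsClosed (H2H10 Ω : Set (Jet2 Ω)) := by
  have e : (H2H10 Ω : Set (Jet2 Ω)) =
      ((⋂ i : Fin d, {U | HasWeakPartial Ω i (jetFst Ω none U) (jetFst Ω (some i) U)}) ∩
        (⋂ (i : Fin d) (j : Fin d),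
          {U | HasWeakPartial Ω j (jetFst Ω (some i) U) (jetSnd Ω (i, j) U)})) ∩
      (fun U : Jet2 Ω => U.fst) ⁻¹' (H10 Ω : Set (Jet1 Ω)) := by
    ext U
    simp only [mem_inter_iff, mem_iInter, mem_ofPred_eq, mem_preimage, jetFst_apply, jetSnd_apply]
    rfl
  rw [e]
  refine IsClosed.inter (IsClosed.inter ?_ ?_) ?_
  · exact isClosed_iInter fun i =>
      isClosed_hasWeakPartial (jetFst Ω _).continuous (jetFst Ω _).continuous
  · exact isClosed_iInter fun i => isClosed_iInter fun j =>
      isClosed_hasWeakPartial (jetFst Ω _).continuous (jetSnd Ω _).continuous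
  · exact (Submodule.isClosed_topologicalClosure _).preimage
      (WithLp.fstL 2 ℝ (Jet1 Ω) (PiLp 2 (fun _ : Fin d × Fin d => L2 Ω))).continuous

instance completeSpace_H2H10 (Ω : Set (EuclideanSpace ℝ (Fin d))) : CompleteSpace (H2H10 Ω) :=
  (isClosed_H2H10 Ω).completeSpace_coe

/-- `H2H10.toL2` as a continuous linear map. -/
def toL2L (Ω : Set (EuclideanSpace ℝ (Fin d))) : H2H10 Ω →L[ℝ] L2 Ω :=
  (jetFst Ω none).comp (H2H10 Ω).subtypeL

lemma toL2L_apply (U : H2H10 Ω) : toL2L Ω U = H2H10.toL2 U := rfl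

lemma pderiv_convolution (ρ : ContDiffBump (0 : EuclideanSpace ℝ (Fin d)))
    {ψ : EuclideanSpace ℝ (Fin d) → ℝ} (hψ : ContDiff ℝ 1 ψ) (hc : HasCompactSupport ψ)
    (i : Fin d) (x : EuclideanSpace ℝ (Fin d)) :
    pderiv i (ρ.normed volume ⋆ ψ) x = (ρ.normed volume ⋆ pderiv i ψ) x := by
  have hl : LocallyIntegrable (ρ.normed volume) volume :=
    ρ.continuous_normed.locallyIntegrable
  have h := hc.hasFDerivAt_convolution_right (ContinuousLinearMap.lsmul ℝ ℝ) hl hψ x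
  rw [pderiv, h.fderiv, convolution_precompR_apply _ hl (hc.fderiv ℝ)
    (hψ.continuous_fderiv one_ne_zero)]
  rfl

lemma continuous_pderiv_of_contDiff {ψ : EuclideanSpace ℝ (Fin d) → ℝ} (hψ : ContDiff ℝ 1 ψ)
    (i : Fin d) : Continuous (pderiv i ψ) :=
  (hψ.continuous_fderiv one_ne_zero).clm_apply continuous_const

lemma exists_isTest_approx (hΩ : IsOpen Ω) {ψ : EuclideanSpace ℝ (Fin d) → ℝ}
    (hψ : ContDiff ℝ 1 ψ) (hc : HasCompactSupport ψ) (hs : tsupport ψ ⊆ Ω) (i : Fin d) {δ : ℝ}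
    (hδ : 0 < δ) :
    ∃ φ, IsTest Ω φ ∧ (∀ x, |φ x - ψ x| ≤ δ) ∧ ∀ x, |pderiv i φ x - pderiv i ψ x| ≤ δ := by
  have hψ' := continuous_pderiv_of_contDiff hψ i
  have hc' : HasCompactSupport (pderiv i ψ) := hc.fderiv_apply ℝ (EuclideanSpace.single i 1)
  obtain ⟨ε1, hε1, h1⟩ := Metric.uniformContinuous_iff.1
    (hc.uniformContinuous_of_continuous hψ.continuous) δ hδ
  obtain ⟨ε2, hε2, h2⟩ := Metric.uniformContinuous_iff.1
    (hc'.uniformContinuous_of_continuous hψ') δ hδ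
  obtain ⟨ε3, hε3, h3⟩ := hc.isCompact.exists_cthickening_subset_open hΩ hs
  -- The mollification radius obeys three constraints: uniform continuity of `ψ`, uniform continuity
  -- of `∂_i ψ`, and room for the support inside `Ω`.
  set ε := min ε1 (min ε2 ε3) with hε
  have hε0 : 0 < ε := lt_min hε1 (lt_min hε2 hε3)
  set ρ : ContDiffBump (0 : EuclideanSpace ℝ (Fin d)) := ⟨ε / 2, ε, half_pos hε0, half_lt_self hε0⟩
  refine ⟨ρ.normed volume ⋆ ψ, ⟨?_, ?_, ?_⟩, fun x => ?_, fun x => ?_⟩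
  · exact ρ.hasCompactSupport_normed.contDiff_convolution_left _ ρ.contDiff_normed
      hψ.continuous.locallyIntegrable
  · exact ρ.hasCompactSupport_normed.convolution _ hc
  · refine Subset.trans (closure_minimal ?_ Metric.isClosed_cthickening) h3
    intro x hx
    obtain ⟨y, hy, z, hz, rfl⟩ := support_convolution_subset _ hx
    rw [ρ.support_normed_eq, mem_ball_zero_iff] at hy
    refine Metric.mem_cthickening_of_dist_le _ z _ _ (subset_tsupport _ hz) ?_
    rw [dist_eq_norm, add_sub_cancel_right]
    exact hy.le.trans ((min_le_right _ _).trans (min_le_right _ _))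
  · exact ρ.dist_normed_convolution_le hψ.continuous.aestronglyMeasurable fun y hy =>
      (h1 (lt_of_lt_of_le hy (min_le_left _ _))).le
  · rw [pderiv_convolution ρ hψ hc]
    exact ρ.dist_normed_convolution_le hψ'.aestronglyMeasurable fun y hy =>
      (h2 (lt_of_lt_of_le hy ((min_le_right _ _).trans (min_le_left _ _)))).le

lemma abs_integral_mul_sub_le {u p q : EuclideanSpace ℝ (Fin d) → ℝ} {δ : ℝ}
    (hu : Integrable u (volume.restrict Ω)) (h : ∀ x, |p x - q x| ≤ δ)
    (hp : Integrable (fun x => u x * p x) (volume.restrict Ω))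
    (hq : Integrable (fun x => u x * q x) (volume.restrict Ω)) :
    |(∫ x in Ω, u x * p x) - ∫ x in Ω, u x * q x| ≤ (∫ x in Ω, |u x|) * δ := by
  rw [← integral_sub hp hq, ← integral_mul_const]
  rw [← Real.norm_eq_abs]
  refine norm_integral_le_of_norm_le (hu.abs.mul_const δ) (Eventually.of_forall fun x => ?_)
  rw [← mul_sub, norm_mul]
  exact mul_le_mul_of_nonneg_left (h x) (abs_nonneg _)

/-- The defining identity of the weak derivative extends to `C¹` test functions. -/
lemma HasWeakPartial.of_contDiff_one (hΩ : IsOpen Ω) (hb : Bornology.IsBounded Ω) {i : Fin d}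
    {u h : L2 Ω} (H : HasWeakPartial Ω i u h) {ψ : EuclideanSpace ℝ (Fin d) → ℝ}
    (hψ : ContDiff ℝ 1 ψ) (hc : HasCompactSupport ψ) (hs : tsupport ψ ⊆ Ω) :
    ∫ x in Ω, u x * pderiv i ψ x = -∫ x in Ω, h x * ψ x := by
  have : IsFiniteMeasure (volume.restrict Ω) := ⟨by
    rw [Measure.restrict_apply_univ]; exact hb.measure_lt_top⟩
  have hu : Integrable u (volume.restrict Ω) := (Lp.memLp u).integrable (by norm_num)
  have hh : Integrable h (volume.restrict Ω) := (Lp.memLp h).integrable (by norm_num)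
  have hψ' := continuous_pderiv_of_contDiff hψ i
  have hc' : HasCompactSupport (pderiv i ψ) := hc.fderiv_apply ℝ (EuclideanSpace.single i 1)
  set N := (∫ x in Ω, |u x|) + ∫ x in Ω, |h x| with hN
  have hN0 : 0 ≤ N := add_nonneg (integral_nonneg fun _ => abs_nonneg _)
    (integral_nonneg fun _ => abs_nonneg _)
  rw [← sub_eq_zero, sub_neg_eq_add]
  refine abs_nonpos_iff.1 (le_of_forall_pos_le_add fun ε hε => ?_)
  -- The total error is at most `N δ`, with `N` the sum of the `L¹` norms; the `+ 1` covers `N = 0`.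
  obtain ⟨φ, hφ, h1, h2⟩ := exists_isTest_approx hΩ hψ hc hs i
    (δ := ε / (N + 1)) (by positivity)
  have b1 := abs_integral_mul_sub_le hu h2
    (integrable_mul_of_compact u (hφ.continuous_pderiv i) (hφ.hasCompactSupport_pderiv i))
    (integrable_mul_of_compact u hψ' hc')
  have b2 := abs_integral_mul_sub_le hh h1
    (integrable_mul_of_compact h hφ.smooth.continuous hφ.compact)
    (integrable_mul_of_compact h hψ.continuous hc)
  rw [H φ hφ] at b1
  have hle : N * (ε / (N + 1)) ≤ ε := by
    rw [← mul_div_assoc, div_le_iff₀ (by positivity)]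
    nlinarith
  have hsum : (∫ x in Ω, |u x|) * (ε / (N + 1)) + (∫ x in Ω, |h x|) * (ε / (N + 1)) ≤ ε := by
    rw [← add_mul]; exact hle
  rw [abs_le] at b1 b2 ⊢
  constructor <;> linarith [b1.1, b1.2, b2.1, b2.2]

/-- By the fundamental lemma of the calculus of variations, `h - h'` vanishes since it is orthogonal
to all test functions. As `u` is an arbitrary function, this also covers the products `a_ij ∂_i v`.
-/
lemma HasWeakPartial.unique (hΩ : IsOpen Ω) {i : Fin d} {u : EuclideanSpace ℝ (Fin d) → ℝ}
    {h h' : L2 Ω} (H : HasWeakPartial Ω i u h) (H' : HasWeakPartial Ω i u h') : h = h' := by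
  have key : ∀ᵐ x ∂volume, x ∈ Ω → (h - h' : L2 Ω) x = 0 := by
    refine hΩ.ae_eq_zero_of_integral_contDiff_smul_eq_zero ?_ fun φ hs hc ht => ?_
    · have : LocallyIntegrable (h - h' : L2 Ω) (volume.restrict Ω) :=
        (Lp.memLp _).locallyIntegrable (by norm_num)
      exact locallyIntegrableOn_of_locallyIntegrable_restrict this
    · have hφ : IsTest Ω φ := ⟨hs, hc, ht⟩
      have e : ∫ x, φ x • (h - h' : L2 Ω) x = ∫ x in Ω, φ x • (h - h' : L2 Ω) x := by
        refine (setIntegral_eq_integral_of_forall_compl_eq_zero fun x hx => ?_).symm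
        rw [image_eq_zero_of_notMem_tsupport (fun h => hx (ht h)), zero_smul]
      have e2 := (pairing_apply hφ.memLp (h - h')).symm
      rw [map_sub, pairing_apply, pairing_apply] at e2
      have := (H φ hφ).symm.trans (H' φ hφ)
      rw [e]
      simp only [smul_eq_mul, mul_comm (φ _)]
      rw [e2]
      linarith
  have : (h - h' : L2 Ω) = 0 := by
    refine (Lp.eq_zero_iff_ae_eq_zero).2 ?_
    exact (ae_restrict_iff' hΩ.measurableSet).2 key
  exact sub_eq_zero.1 this

/-- A continuous function on the closure of a bounded open set is a bounded multiplier. -/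
lemma memLp_top_of_continuousOn_closure (hΩ : IsOpen Ω) (hb : Bornology.IsBounded Ω)
    {m : EuclideanSpace ℝ (Fin d) → ℝ} (hm : ContinuousOn m (closure Ω)) :
    MemLp m ⊤ (volume.restrict Ω) := by
  obtain ⟨C, hC⟩ := hb.isCompact_closure.exists_bound_of_continuousOn hm
  refine memLp_top_of_bound ((hm.mono subset_closure).aestronglyMeasurable hΩ.measurableSet) C ?_
  filter_upwards [ae_restrict_mem hΩ.measurableSet] with x hx
  exact hC x (subset_closure hx)

/-- Multiplication by a bounded function on `L²(Ω)`. -/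
def mulL {m : EuclideanSpace ℝ (Fin d) → ℝ} (hm : MemLp m ⊤ (volume.restrict Ω)) :
    L2 Ω →L[ℝ] L2 Ω :=
  (ContinuousLinearMap.mul ℝ ℝ).holderL (volume.restrict Ω) ⊤ 2 2 (hm.toLp m)

lemma coeFn_mulL {m : EuclideanSpace ℝ (Fin d) → ℝ} (hm : MemLp m ⊤ (volume.restrict Ω))
    (u : L2 Ω) : mulL hm u =ᵐ[volume.restrict Ω] fun x => m x * u x := by
  filter_upwards [(ContinuousLinearMap.mul ℝ ℝ).coeFn_holder (r := 2) (hm.toLp m) u,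
    hm.coeFn_toLp] with x h1 h2
  rw [mulL, ContinuousLinearMap.holderL_apply_apply, h1, h2]
  rfl

/-- Differentiability of `a` is known only inside `Ω`; off the support of the product, which lies in
`Ω`, the product is locally zero. -/
lemma contDiff_mul_test {a : EuclideanSpace ℝ (Fin d) → ℝ}
    {D : EuclideanSpace ℝ (Fin d) → (EuclideanSpace ℝ (Fin d) →L[ℝ] ℝ)} (hΩ : IsOpen Ω)
    (hD : ContinuousOn D (closure Ω)) (ha : ∀ x ∈ Ω, HasFDerivAt a (D x) x)
    {φ : EuclideanSpace ℝ (Fin d) → ℝ} (hφ : IsTest Ω φ) :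
    ContDiff ℝ 1 (fun x => a x * φ x) := by
  refine contDiff_iff_contDiffAt.2 fun x => ?_
  by_cases hx : x ∈ tsupport fun x => a x * φ x
  swap
  · exact (contDiffAt_const (c := (0 : ℝ))).congr_of_eventuallyEq
      (notMem_tsupport_iff_eventuallyEq.1 hx)
  have hxΩ : x ∈ Ω :=
    hφ.support ((closure_mono (Function.support_mul_subset_right a φ)) hx)
  have hax : ContDiffAt ℝ 1 a x :=
    contDiffAt_one_iff.2 ⟨D, Ω, hΩ.mem_nhds hxΩ, hD.mono subset_closure, ha⟩
  exact hax.mul (hφ.smooth.contDiffAt.of_le (by simp))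

/-- The product rule for a `C¹(Ω̄)` coefficient and a function with a weak derivative in `L²`. -/
lemma HasWeakPartial.mul_coeff (hΩ : IsOpen Ω) (hb : Bornology.IsBounded Ω)
    {a : EuclideanSpace ℝ (Fin d) → ℝ}
    {D : EuclideanSpace ℝ (Fin d) → (EuclideanSpace ℝ (Fin d) →L[ℝ] ℝ)}
    (hac : MemLp a ⊤ (volume.restrict Ω)) (hD : ContinuousOn D (closure Ω))
    (ha : ∀ x ∈ Ω, HasFDerivAt a (D x) x) {j : Fin d}
    (hDj : MemLp (fun x => D x (EuclideanSpace.single j 1)) ⊤ (volume.restrict Ω))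
    {p r : L2 Ω} (H : HasWeakPartial Ω j p r) :
    HasWeakPartial Ω j (fun x => a x * p x) (mulL hac r + mulL hDj p : L2 Ω) := by
  intro φ hφ
  have hψ := contDiff_mul_test hΩ hD ha hφ
  have hψs : tsupport (fun x => a x * φ x) ⊆ Ω :=
    (closure_mono (Function.support_mul_subset_right a φ)).trans hφ.support
  -- The product `a φ` is only `C¹`, so the definition of the weak derivative must first be extended
  -- to such test functions.
  have key := H.of_contDiff_one hΩ hb hψ hφ.compact.mul_left hψs
  have hpd : ∀ x ∈ Ω, pderiv j (fun x => a x * φ x) x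
      = a x * pderiv j φ x + D x (EuclideanSpace.single j 1) * φ x := by
    intro x hx
    have h := (ha x hx).mul (hφ.smooth.differentiable (by simp) x).hasFDerivAt
    have h' : HasFDerivAt (fun x => a x * φ x) (a x • fderiv ℝ φ x + φ x • D x) x := h
    rw [pderiv, h'.fderiv, pderiv]
    simp [mul_comm]
  have i1 := integrable_mul_of_compact (mulL hac p) (hφ.continuous_pderiv j)
    (hφ.hasCompactSupport_pderiv j)
  have i2 := integrable_mul_of_compact (mulL hDj p) hφ.smooth.continuous hφ.compact
  have i3 := integrable_mul_of_compact (mulL hac r) hφ.smooth.continuous hφ.compact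
  have e1 : ∫ x in Ω, p x * pderiv j (fun x => a x * φ x) x
      = (∫ x in Ω, mulL hac p x * pderiv j φ x) + ∫ x in Ω, mulL hDj p x * φ x := by
    rw [← integral_add i1 i2]
    refine integral_congr_ae ?_
    filter_upwards [coeFn_mulL hac p, coeFn_mulL hDj p, ae_restrict_mem hΩ.measurableSet]
      with x h1 h2 hx
    rw [h1, h2, hpd x hx]
    ring
  have e2 : ∫ x in Ω, r x * (a x * φ x) = ∫ x in Ω, mulL hac r x * φ x := by
    refine integral_congr_ae ?_
    filter_upwards [coeFn_mulL hac r] with x h1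
    rw [h1]
    ring
  have e3 : ∫ x in Ω, a x * p x * pderiv j φ x = ∫ x in Ω, mulL hac p x * pderiv j φ x := by
    refine integral_congr_ae ?_
    filter_upwards [coeFn_mulL hac p] with x h1
    rw [h1]
  have e4 : ∫ x in Ω, (mulL hac r + mulL hDj p : L2 Ω) x * φ x
      = (∫ x in Ω, mulL hac r x * φ x) + ∫ x in Ω, mulL hDj p x * φ x := by
    rw [← integral_add i3 i2]
    refine integral_congr_ae ?_
    filter_upwards [Lp.coeFn_add (mulL hac r) (mulL hDj p)] with x h1
    rw [h1, Pi.add_apply, add_mul]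
  rw [e3, e4]
  rw [e1, e2] at key
  linarith

lemma coeFn_sum {ι : Type*} (S : Finset ι) (F : ι → L2 Ω) :
    (∑ i ∈ S, F i : L2 Ω) =ᵐ[volume.restrict Ω] fun x => ∑ i ∈ S, F i x := by
  classical
  induction S using Finset.induction_on with
  | empty =>
    simp only [Finset.sum_empty]
    exact Lp.coeFn_zero ℝ 2 (volume.restrict Ω)
  | insert i S hi ih =>
    rw [Finset.sum_insert hi]
    filter_upwards [Lp.coeFn_add (F i) (∑ i ∈ S, F i), ih] with x h1 h2
    rw [h1, Pi.add_apply, h2, Finset.sum_insert hi]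

/-- Uniqueness of weak derivatives fixes `p`, then `q`, and so `h`: the relation is single-valued.
-/
lemma EllipticOperator.MapsTo.unique (hΩ : IsOpen Ω) {A : EllipticOperator Ω} {v h h' : L2 Ω}
    (H : A.MapsTo v h) (H' : A.MapsTo v h') : h = h' := by
  obtain ⟨p, q, hp, hq, hh⟩ := H
  obtain ⟨p', q', hp', hq', hh'⟩ := H'
  obtain rfl : p = p' := funext fun i => (hp i).unique hΩ (hp' i)
  obtain rfl : q = q' := funext fun i => funext fun j => (hq i j).unique hΩ (hq' i j)
  refine Lp.ext ?_
  filter_upwards [hh, hh'] with x h1 h2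
  rw [h1, h2]

/-- The elliptic operator as a continuous linear map on `H²(Ω) ∩ H¹₀(Ω)`. -/
lemma EllipticOperator.exists_clm (hΩ : IsOpen Ω) (hb : Bornology.IsBounded Ω)
    (A : EllipticOperator Ω) :
    ∃ L : H2H10 Ω →L[ℝ] L2 Ω, ∀ U : H2H10 Ω, A.MapsTo (H2H10.toL2 U) (L U) := by
  choose hac D hD ha using A.a_C1
  have ha' : ∀ i j, MemLp (A.a i j) ⊤ (volume.restrict Ω) := fun i j =>
    memLp_top_of_continuousOn_closure hΩ hb (hac i j)
  have hD' : ∀ i j, MemLp (fun x => D i j x (EuclideanSpace.single j 1)) ⊤ (volume.restrict Ω) :=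
    fun i j => memLp_top_of_continuousOn_closure hΩ hb ((hD i j).clm_apply continuousOn_const)
  have hb' : ∀ j, MemLp (A.b j) ⊤ (volume.restrict Ω) := fun j =>
    memLp_top_of_continuousOn_closure hΩ hb (A.b_cont j)
  have hc' : MemLp A.c ⊤ (volume.restrict Ω) :=
    memLp_top_of_continuousOn_closure hΩ hb A.c_cont
  -- The product rule `∂_j (a_ij ∂_i v) = a_ij ∂_j ∂_i v + (∂_j a_ij) ∂_i v`, read as a bounded map
  -- on jets.
  set Q : Fin d → Fin d → Jet2 Ω →L[ℝ] L2 Ω := fun i j =>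
    (mulL (ha' i j)).comp (jetSnd Ω (i, j)) + (mulL (hD' i j)).comp (jetFst Ω (some i)) with hQ
  set L : Jet2 Ω →L[ℝ] L2 Ω := -(∑ i, ∑ j, Q i j) +
    (∑ j, (mulL (hb' j)).comp (jetFst Ω (some j))) + (mulL hc').comp (jetFst Ω none) with hL
  refine ⟨L.comp (H2H10 Ω).subtypeL, fun U => ?_⟩
  obtain ⟨⟨hU1, hU2⟩, -⟩ := U.2
  refine ⟨fun i => (U : Jet2 Ω).fst (some i), fun i j => Q i j U, hU1, fun i j => ?_, ?_⟩
  · exact (hU2 i j).mul_coeff hΩ hb (ha' i j) (hD i j) (ha i j) (hD' i j)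
  · have e : (L.comp (H2H10 Ω).subtypeL) U = -(∑ q : Fin d × Fin d, Q q.1 q.2 U) +
        (∑ j, mulL (hb' j) ((U : Jet2 Ω).fst (some j))) + mulL hc' ((U : Jet2 Ω).fst none) := by
      simp only [hL, Fintype.sum_prod_type]
      simp [jetFst_apply]
    have hB : ∀ᵐ x ∂(volume.restrict Ω), ∀ j, mulL (hb' j) ((U : Jet2 Ω).fst (some j)) x
        = A.b j x * (U : Jet2 Ω).fst (some j) x := by
      rw [ae_all_iff]
      exact fun j => coeFn_mulL (hb' j) _
    rw [e]
    filter_upwards [Lp.coeFn_add (-(∑ q : Fin d × Fin d, Q q.1 q.2 U) +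
        (∑ j, mulL (hb' j) ((U : Jet2 Ω).fst (some j)))) (mulL hc' ((U : Jet2 Ω).fst none)),
      Lp.coeFn_add (-(∑ q : Fin d × Fin d, Q q.1 q.2 U))
        (∑ j, mulL (hb' j) ((U : Jet2 Ω).fst (some j))),
      Lp.coeFn_neg (∑ q : Fin d × Fin d, Q q.1 q.2 U),
      coeFn_sum Finset.univ fun q : Fin d × Fin d => Q q.1 q.2 U,
      coeFn_sum Finset.univ fun j => mulL (hb' j) ((U : Jet2 Ω).fst (some j)),
      coeFn_mulL hc' ((U : Jet2 Ω).fst none), hB] with x h1 h2 h3 h4 h5 h6 h7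
    rw [h1, Pi.add_apply, h2, Pi.add_apply, h3, Pi.neg_apply, h4, h5, h6,
      Fintype.sum_prod_type (fun q : Fin d × Fin d => (Q q.1 q.2 (U : Jet2 Ω) : L2 Ω) x)]
    simp only [h7]
    rfl

end Weak

/-! ### Duhamel's formula for Riemann–Liouville integrals -/

section Duhamel

variable {X : Type*} [NormedAddCommGroup X] [NormedSpace ℝ X] [CompleteSpace X]

/-- Duhamel's formula at the level of Riemann-Liouville integrals: if `v = J_α y` then
`g * (v + f) = J_α (J_{1-α} g f + g * y)`. -/
lemma rlIntegral_duhamel {α T : ℝ} (h0 : 0 < α) (h1 : α < 1) {g : ℝ → ℝ}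
    (hg : MemLp g 2 (timeMeasure T)) {v y : ℝ → X} (f : X) (hv : MemLp v 2 (timeMeasure T))
    (hy : MemLp y 2 (timeMeasure T)) (hvy : ∀ᵐ t ∂(timeMeasure T), rlIntegral α y t = v t) :
    ∀ᵐ t ∂(timeMeasure T),
      rlIntegral α (fun s => rlIntegral (1 - α) g s • f + causalConv g y s) t
        = causalConv g (fun s => v s + f) t := by
  have hgi := integrable_of_memLp_two hg
  have hyi := integrable_of_memLp_two hy
  have hκ := integrable_rlKernel (T := T) h0
  have hκ' := integrable_rlKernel (T := T) (sub_pos.2 h1)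
  have hgf : Integrable (fun s => g s • f) (timeMeasure T) := hgi.smul_const f
  have hvy' : v =ᵐ[timeMeasure T] causalConv (rlKernel α) y := by
    filter_upwards [hvy] with t ht
    rw [← ht, rlIntegral_eq_causalConv]
  have e1 : (fun s => rlIntegral (1 - α) g s • f) = causalConv (rlKernel (1 - α)) fun s => g s • f := by
    ext1 s
    rw [causalConv_smul_const, rlIntegral_eq_causalConv]
  have hcomm : causalConv g (rlKernel α) = causalConv (rlKernel α) g :=
    funext fun t => causalConv_comm _ _ _
  have hone : causalConv (rlKernel α) (rlKernel (1 - α)) =ᵐ[timeMeasure T] fun _ => (1 : ℝ) := by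
    filter_upwards [ae_restrict_mem measurableSet_Ioo] with t ht
    exact causalConv_rlKernel_rlKernel h0 h1 ht.1
  filter_upwards [ae_restrict_mem measurableSet_Ioo,
    ae_causalConvExists hκ (integrable_causalConv hκ' hgf),
    ae_causalConvExists hκ (integrable_causalConv hgi hyi),
    causalConv_assoc hκ hκ' hgf, causalConv_assoc hκ hgi hyi, causalConv_assoc hgi hκ hyi]
    with t ht x1 x2 a1 a2 a3
  rw [rlIntegral_eq_causalConv]
  have e2 : (fun s => rlIntegral (1 - α) g s • f + causalConv g y s)
      = fun s => causalConv (rlKernel (1 - α)) (fun s => g s • f) s + causalConv g y s := by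
    ext1 s
    rw [← e1]
  -- `a1` turns the `f` term into `1 * (g f)`; `a2`, `a3` and commutativity identify `k_α * (g * y)`
  -- with `g * (k_α * y)`. What remains is `1 * (g f) = g * f`.
  rw [e2, CausalConvExists.add_right ht.1.le x1 x2,
    CausalConvExists.add_right ht.1.le (causalConvExists_of_memLp_two ht hg hv)
      (causalConvExists_of_memLp_two ht hg (memLp_const f)),
    causalConv_congr ht (ae_eq_refl g) hvy', ← a1, ← a2, ← a3, hcomm,
    causalConv_congr ht hone (ae_eq_refl _), add_comm]
  congr 1
  have hc : causalConv (fun _ => (1 : ℝ)) (fun s => g s • f) t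
      = causalConv g (fun _ => (1 : ℝ)) t • f := by
    rw [causalConv_smul_const, causalConv_comm]
  rw [hc, ← causalConv_smul_const]
  simp

end Duhamel

end FracDuhamel

end

open FracDuhamel

/-- **Duhamel's principle** in `_αH(0,T)`. -/
theorem lemma3p1 {d : ℕ} (hd : 1 ≤ d) (Ω : Set (EuclideanSpace ℝ (Fin d)))
    (hΩ : IsSmoothBoundedDomain Ω) (A : EllipticOperator Ω)
    (α T : ℝ) (hα0 : 0 < α) (hα1 : α < 1) (hT : 0 < T)
    (g : ℝ → ℝ) (hg : MemLp g 2 (timeMeasure T)) (f : L2 Ω)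
    (z : ℝ → L2 Ω)
    (hz_eq : FracEquation A α T (fun t => z t - f) z (fun _ => 0))
    (hz_frac : (fun t => z t - f) ∈ zeroFracSobolev α T)
    (hz_space : MemL2H2H10 Ω T z)
    (w : ℝ → L2 Ω)
    (hw : ∀ t ∈ Ioo 0 T, w t = ∫ s in (0 : ℝ)..t, g s • z (t - s)) :
    FracEquation A α T w w (fun t => rlIntegral (1 - α) g t • f) ∧
      w ∈ zeroFracSobolev α T ∧ MemL2H2H10 Ω T w := by
  obtain ⟨y, h, hy, hh, hAh, hyh⟩ := hz_eq
  obtain ⟨Z, hZ, hzZ⟩ := hz_space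
  obtain ⟨L, hL⟩ := A.exists_clm hΩ.isOpen hΩ.isBounded
  set v : ℝ → L2 Ω := fun t => z t - f with hv_def
  have hvL : MemLp v 2 (timeMeasure T) := hz_frac.1.1
  have hvz : (fun t => v t + f) = z := by
    ext1 t
    simp [hv_def]
  have hwz : w =ᵐ[timeMeasure T] causalConv g z := by
    filter_upwards [ae_restrict_mem measurableSet_Ioo] with t ht using hw t ht
  have hvg : gagliardo α (Ioo 0 T) v < ⊤ := by
    have h2 := hz_frac.1.2
    rw [slobodeckiNorm_eq] at h2
    have h3 := (ENNReal.rpow_lt_top_iff_of_pos (by norm_num)).1 h2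
    exact (ENNReal.add_lt_top.1 h3).2
  -- The vanishing of `v` at time `0` enters through `v = J_α y` and Hardy's inequality.
  have hvw : ∫⁻ t in Ioo 0 T, ‖v t‖ₑ ^ 2 * ENNReal.ofReal (t ^ (-(2 * α))) < ⊤ := by
    refine lt_of_le_of_lt (le_of_eq (lintegral_congr_ae ?_)) (hardy_rlKernel (T := T) hα0 hy.memLp)
    filter_upwards [hy.rlIntegral_eq] with t ht
    rw [← ht, rlIntegral_eq_causalConv]
  have hwdom : w ∈ zeroFracSobolev α T := by
    have hm := mem_zeroFracSobolev_causalConv hα0 hα1 hT hvL hvg hvw f hg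
    rw [hvz] at hm
    refine ⟨⟨hm.1.1.ae_eq hwz.symm, by rw [slobodeckiNorm_congr_ae hwz]; exact hm.1.2⟩,
      fun ε hε => ?_⟩
    obtain ⟨φ, hφ, hb⟩ := hm.2 ε hε
    refine ⟨φ, hφ, ?_⟩
    rwa [slobodeckiNorm_congr_ae (v := fun t => causalConv g z t - φ t)]
    filter_upwards [hwz] with t ht
    rw [ht]
  have hZL : MemLp (fun t => L (Z t)) 2 (timeMeasure T) := L.comp_memLp' hZ
  have hhL : h =ᵐ[timeMeasure T] fun t => L (Z t) := by
    filter_upwards [hAh, hzZ] with t h1 h2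
    rw [h2] at h1
    exact h1.unique hΩ.isOpen (hL (Z t))
  -- The convolution is formed in `H² ∩ H¹₀` and then embedded, which shows at once that `w` takes
  -- values in that space.
  have hwZ : ∀ t ∈ Ioo 0 T, w t = H2H10.toL2 (causalConv g Z t) := fun t ht => by
    rw [hw t ht, ← toL2L_apply,
      clm_causalConv (toL2L Ω) ht.1.le (causalConvExists_of_memLp_two ht hg hZ)]
    exact causalConv_congr ht (ae_eq_refl g) hzZ
  have hWL : MemLp (causalConv g Z) 2 (timeMeasure T) := memLp_causalConv_of_memLp_two hg hZ
  -- The fractional derivative of `w` is `(J_{1-α} g) f + g * y`, and `A w` is `L (g * Z)`.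
  refine ⟨⟨fun s => rlIntegral (1 - α) g s • f + causalConv g y s, fun t => L (causalConv g Z t),
    ⟨hwdom, ?_, ?_⟩, L.comp_memLp' hWL, ?_, ?_⟩, hwdom, causalConv g Z, hWL, ?_⟩
  · refine MemLp.add ?_ (memLp_causalConv_of_memLp_two hg hy.memLp)
    have hJ : MemLp (rlIntegral (1 - α) g) 2 (timeMeasure T) := by
      rw [show rlIntegral (1 - α) g = causalConv (rlKernel (1 - α)) g from
        funext fun t => rlIntegral_eq_causalConv (1 - α) g t]
      exact memLp_causalConv_of_integrable (integrable_rlKernel (sub_pos.2 hα1)) hg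
    exact (ContinuousLinearMap.toSpanSingleton ℝ f).comp_memLp' hJ
  · have hduh := rlIntegral_duhamel hα0 hα1 hg f hvL hy.memLp hy.rlIntegral_eq
    rw [hvz] at hduh
    filter_upwards [hduh, hwz] with t h1 h2
    rw [h1, h2]
  · filter_upwards [ae_restrict_mem measurableSet_Ioo] with t ht
    rw [hwZ t ht]
    exact hL _
  · have hneg : y =ᵐ[timeMeasure T] fun t => (-1 : ℝ) • L (Z t) := by
      filter_upwards [hyh, hhL] with t h1 h2
      rw [← h2, neg_one_smul]
      exact eq_neg_of_add_eq_zero_left h1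
    have hZn : MemLp (fun t => (-1 : ℝ) • L (Z t)) 2 (timeMeasure T) := hZL.const_smul (-1 : ℝ)
    filter_upwards [ae_restrict_mem measurableSet_Ioo] with t ht
    rw [causalConv_congr ht (ae_eq_refl g) hneg,
      clm_causalConv L ht.1.le (causalConvExists_of_memLp_two ht hg hZ), add_assoc,
      ← CausalConvExists.add_right ht.1.le
        (causalConvExists_of_memLp_two ht hg hZn)
        (causalConvExists_of_memLp_two ht hg hZL)]
    simp [causalConv]
  · filter_upwards [ae_restrict_mem measurableSet_Ioo] with t ht using hwZ t ht
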